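/- **Notation.** For $\mu>0$ put $\delta_\mu(t)=t^{\mu-1}/\Gamma(\mu)$, let ${}_0D_t^{-\mu}y=\delta_\mu*y$ be the Riemann–Liouville fractional integral (the identity for $\mu=0$), and with $n=\lceil\mu\rceil$ let ${}^C_0D_t^{\mu}y={}_0D_t^{-(n-\mu)}y^{(n)}$ and ${}_0D_t^{\mu}y=\frac{d^n}{dt^n}\,{}_0D_t^{-(n-\mu)}y$ be the Caputo and the Riemann–Liouville derivative. For $0<\nu\le\frac12$ and $t>0$ let $R_{\mu,\nu}(a,t)=\mathcal L^{-1}\{s^{-\mu}e^{-as^\nu};t\}$ for $a>0$ and $R_{\mu,\nu}(0,t)=R_{\mu,\nu}(0+,t)=\delta_\mu(t)$, and let $W(z;\alpha,\beta)=\sum_{j\ge0}\frac{z^j}{j!\,\Gamma(\alpha j+\beta)}$ be the Wright function. For $r>0$ and $u_0\in\mathbb R$ consider the moving boundary problem for $u(x,t)$ and $\eta(t)>0$ $$ \begin{cases} D^{2\nu}u=\partial_x^2u, & 0<x<\eta(t),\ t>0,\\ \Phi u(x,0+)=u_0, & x>0,\\ u(0,t)=1,\quad u(\eta(t),t)=0,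 & t>0,\\ D^{2\nu}\eta(t)=-\frac1r\,\partial_xu(\eta(t),t), & t>0, \end{cases} $$ where either $D^{2\nu}={}^C_0D_t^{2\nu}$ and $\Phi u=u$ (Caputo case), or $D^{2\nu}={}_0D_t^{2\nu}$ and $\Phi u={}_0D_t^{-(1-2\nu)}u$ (Riemann–Liouville case). **(1) Caputo case.** Let $0<\nu\le\frac12$ and $r>0$. The transcendental equation $$\frac{2\alpha r\,\Gamma(1+\nu)}{\Gamma(1-\nu)}\,[1-W(-2\alpha;-\nu,1)]=W(-2\alpha;-\nu,1-\nu)\tag{$*$}$$ has a solution $\alpha>0$. For every $\alpha>0$ one has $W(-2\alpha;-\nu,1)\ne1$, and for every $u_0\in\mathbb R$ the pair $$u(x,t)=\frac{R_{1,\nu}(x,t)-W(-2\alpha;-\nu,1)}{1-W(-2\alpha;-\nu,1)},\qquad \eta(t)=2\alpha t^\nu$$ solves the Caputo problem if and only if $\alpha$ satisfies $(*)$ and $u_0=-\dfrac{W(-2\alpha;-\nu,1)}{1-W(-2\alpha;-\nu,1)}$. **(2) Riemann–Liouville case.** Let $0<\nu<\frac12$ and $u_0\in\mathbb R$. Consider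 the functions $$u(x,t)=\int_{-\infty}^{\infty}\tfrac12R_{\nu,\nu}(|x-\xi|,t)\,u_0\chi_{\mathbb R\setminus\{0\}}(\xi)\,d\xi+\int_0^t\tfrac12R_{2\nu,\nu}(x,t-\tau)\,\varphi^-(\tau)\,d\tau,\qquad x\ge0,\ t>0,$$ with $\varphi^-=\varphi+c\,\delta$, where $\varphi$ is integrable on $(0,t)$ for each $t>0$, $c\in\mathbb R$, and $\delta$ is the Dirac delta at $0$. The choice $\varphi=2\delta_{1-2\nu}$, $c=-2u_0$ is admissible and gives $u(x,t)=u_0\delta_{2\nu}(t)+R_{1,\nu}(x,t)-u_0R_{2\nu,\nu}(x,t)$, which satisfies $u(0,t)=1$ for all $t>0$. But for no such $\varphi$, $c$ and no $\alpha>0$ do both boundary conditions $u(0,t)=1$ and $u(2\alpha t^\nu,t)=0$ hold for all $t>0$; in particular, for no $r>0$ does such a $u$ together with $\eta(t)=2\alpha t^\nu$ solve the Riemann–Liouville problem. **(3) Classical case.** For $\nu=\frac12$ and $\alpha>0$ the pair in (1) is the Neumann solution $$u(x,t)=1-\frac{\operatorname{erf}\bigl(\frac{x}{2\sqrt t}\bigr)}{\operatorname{erf}(\alpha)}\quad(x\ge0,\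 t>0),\qquad \eta(t)=2\alpha\sqrt t\quad(t\ge0),$$ and for every $r>0$ equation $(*)$ is equivalent to $r\sqrt\pi\,\alpha\operatorname{erf}(\alpha)\,e^{\alpha^2}=1$. -/

import Mathlib

open Filter Topology

noncomputable section

/-- The function `δ_μ(t) = t ^ (μ - 1) / Γ(μ)` for `μ > 0`. -/
def fracDelta (μ t : ℝ) : ℝ := t ^ (μ - 1) / Real.Gamma μ

/-- The Riemann-Liouville fractional integral of order `μ ≥ 0` with base point `0`;
the integral of order `0` is the identity. -/
def rlIntegral (μ : ℝ) (y : ℝ → ℝ) (t : ℝ) : ℝ :=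
  if μ = 0 then y t
  else 1 / Real.Gamma μ * ∫ τ in (0 : ℝ)..t, (t - τ) ^ (μ - 1) * y τ

/-- The integral defining `rlIntegral μ y t` converges absolutely. -/
def RLIntegrable (μ : ℝ) (y : ℝ → ℝ) (t : ℝ) : Prop :=
  μ = 0 ∨ IntervalIntegrable (fun τ => (t - τ) ^ (μ - 1) * y τ) MeasureTheory.volume 0 t

/-- `y` has at `t > 0` the Caputo fractional derivative `d` of order `μ`: with `n = ⌈μ⌉`, the
function `y` is `C^n` on `(0, ∞)`, and the fractional integral of order `n - μ` of its `n`-th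
derivative converges at `t` and equals `d`. -/
def HasCaputoDeriv (μ : ℝ) (y : ℝ → ℝ) (t d : ℝ) : Prop :=
  ContDiffOn ℝ (⌈μ⌉₊ : ℕ) y (Set.Ioi 0) ∧
  RLIntegrable ((⌈μ⌉₊ : ℝ) - μ) (iteratedDeriv ⌈μ⌉₊ y) t ∧
  rlIntegral ((⌈μ⌉₊ : ℝ) - μ) (iteratedDeriv ⌈μ⌉₊ y) t = d

/-- `y` has at `t > 0` the Riemann-Liouville fractional derivative `d` of order `μ`: with
`n = ⌈μ⌉`, the fractional integral of order `n - μ` of `y` converges near `t`, is `C^n` near `t`,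
and its `n`-th derivative at `t` is `d`. -/
def HasRLDeriv (μ : ℝ) (y : ℝ → ℝ) (t d : ℝ) : Prop :=
  (∀ᶠ s in 𝓝 t, RLIntegrable ((⌈μ⌉₊ : ℝ) - μ) y s) ∧
  ContDiffAt ℝ (⌈μ⌉₊ : ℕ) (rlIntegral ((⌈μ⌉₊ : ℝ) - μ) y) t ∧
  iteratedDeriv ⌈μ⌉₊ (rlIntegral ((⌈μ⌉₊ : ℝ) - μ) y) t = d

/-- The inverse Laplace transform, as the Bromwich integral
`(1 / 2πi) ∫ e ^ (s t) F(s) ds` along the line `Re s = 1` (for `F` holomorphic in the right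
half-plane and decaying along vertical lines, the abscissa does not matter); `F` is assumed
to be real on the real axis, so that the integral is real. -/
def inverseLaplace (F : ℂ → ℂ) (t : ℝ) : ℝ :=
  (1 / (2 * (Real.pi : ℂ)) *
    ∫ y : ℝ, Complex.exp ((1 + y * Complex.I) * t) * F (1 + y * Complex.I)).re

/-- The auxiliary function `R_{μ,ν}(a,t)`, the inverse Laplace transform of
`s ^ (-μ) * exp (-a s ^ ν)`, for `a > 0`. For `a = 0`, where (for `μ > 0`) the transform
`s ^ (-μ)` has the inverse `δ_μ(t)`, the value is `δ_μ(t)`. -/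
def auxR (μ ν a t : ℝ) : ℝ :=
  if a = 0 then fracDelta μ t
  else inverseLaplace (fun s => s ^ (-(μ : ℂ)) * Complex.exp (-(a : ℂ) * s ^ (ν : ℂ))) t

/-- The Wright function `W(z; α, β) = ∑ z ^ j / (j! Γ(α j + β))` for real arguments. At the poles
of `Γ` the coefficient is `0`, in agreement with `Real.Gamma (-n) = 0` and `x / 0 = 0`. -/
def wrightW (z α β : ℝ) : ℝ :=
  ∑' j : ℕ, z ^ j / ((j.factorial : ℝ) * Real.Gamma (α * j + β))

/-- The error function. -/
def errorFun (x : ℝ) : ℝ := 2 / Real.sqrt Real.pi * ∫ s in (0 : ℝ)..x, Real.exp (-s ^ 2)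

/-- The pair `(u, η)` solves the Stefan problem
`D u = u_xx` for `0 < x < η(t)`, `t > 0`;
`Φ u(x, 0+) = u₀` for `x > 0`;
`u(0,t) = 1`, `u(η(t),t) = 0` for `t > 0`;
`D η(t) = -(1/r) u_x(η(t),t)` for `t > 0`.
Here `HasD y t d` means that `D y` exists at `t` and equals `d`, where `D` is a fractional
derivative in time, and `Φ` is the corresponding operator in the initial condition. The boundary
value at `x = 0` is attained continuously, and `u_x(η(t),t)` is the derivative from the left (so
that the boundary value at `x = η(t)` is attained continuously, too). -/
structure IsStefanSolution (HasD : (ℝ → ℝ) → ℝ → ℝ → Prop) (Φ : (ℝ → ℝ) → ℝ → ℝ)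
    (r u₀ : ℝ) (u : ℝ → ℝ → ℝ) (η : ℝ → ℝ) : Prop where
  boundary_pos : ∀ t > 0, 0 < η t
  pde : ∀ t > 0, ∀ x, 0 < x → x < η t →
    ContDiffAt ℝ 2 (fun ξ => u ξ t) x ∧
      HasD (fun τ => u x τ) t (iteratedDeriv 2 (fun ξ => u ξ t) x)
  initial : ∀ x > 0, Tendsto (fun t => Φ (fun τ => u x τ) t) (𝓝[>] 0) (𝓝 u₀)
  left_value : ∀ t > 0, u 0 t = 1
  left_continuous : ∀ t > 0, ContinuousWithinAt (fun x => u x t) (Set.Ici 0) 0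
  right_value : ∀ t > 0, u (η t) t = 0
  stefan : ∀ t > 0, ∃ q, HasDerivWithinAt (fun x => u x t) q (Set.Iic (η t)) (η t) ∧
    HasD η t (-(1 / r) * q)

/-- Solutions of the Stefan problem with the Caputo derivative of order `2ν`; the initial
condition is `u(x, 0+) = u₀`. -/
def IsCaputoStefanSolution (ν r u₀ : ℝ) (u : ℝ → ℝ → ℝ) (η : ℝ → ℝ) : Prop :=
  IsStefanSolution (HasCaputoDeriv (2 * ν)) (fun y => y) r u₀ u η

/-- Solutions of the Stefan problem with the Riemann-Liouville derivative of order `2ν`; the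
initial condition prescribes the fractional integral of order `1 - 2ν` of `u(x, ·)` at `0+`. -/
def IsRLStefanSolution (ν r u₀ : ℝ) (u : ℝ → ℝ → ℝ) (η : ℝ → ℝ) : Prop :=
  IsStefanSolution (HasRLDeriv (2 * ν)) (rlIntegral (1 - 2 * ν)) r u₀ u η

/-- The similarity solution of the Caputo problem. -/
def similarityU (ν α x t : ℝ) : ℝ :=
  (auxR 1 ν x t - wrightW (-2 * α) (-ν) 1) / (1 - wrightW (-2 * α) (-ν) 1)

/-- The similarity ansatz for the moving boundary. -/
def similarityEta (ν α t : ℝ) : ℝ := 2 * α * t ^ ν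

/-- The transcendental equation for `α`. -/
def TranscendentalEq (ν r α : ℝ) : Prop :=
  2 * α * r * Real.Gamma (1 + ν) / Real.Gamma (1 - ν) * (1 - wrightW (-2 * α) (-ν) 1)
    = wrightW (-2 * α) (-ν) (1 - ν)

/-- The embedding representation of solutions of the Riemann-Liouville time-fractional diffusion
equation on `x ≥ 0` with initial datum `u₀` on `x ≠ 0` and with the source
`φ⁻(t) = φ(t) + c δ(t)` (`δ` the Dirac delta at `0`) on `x ≤ 0`, and no other source:
`u(x,t) = ∫ ½ R_{ν,ν}(|x - ξ|,t) f(ξ) dξ + ∫_0^t ½ R_{2ν,ν}(x,t - τ) φ⁻(τ) dτ`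
with `f = u₀` on `ℝ \ {0}` and `f(0) = 0`. -/
def rlEmbedding (ν u₀ : ℝ) (φ : ℝ → ℝ) (c x t : ℝ) : ℝ :=
  (∫ ξ : ℝ, 1 / 2 * auxR ν ν |x - ξ| t * (if ξ = 0 then 0 else u₀)) +
  ((∫ τ in (0 : ℝ)..t, 1 / 2 * auxR (2 * ν) ν x (t - τ) * φ τ) +
    1 / 2 * c * auxR (2 * ν) ν x t)

end

open MeasureTheory Set
open scoped Real ComplexConjugate

/-!
Rotating the Bromwich contour of `R_{μ,ν}(a,·)` onto rays in the left half-plane gives exponential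
convergence, and expanding `exp (-a s ^ ν)` there yields the similarity form
`R_{μ,ν}(a,t) = t ^ (μ - 1) W(-a t ^ (-ν); -ν, μ)`. Moreover `∂ₐR_{μ,ν} = -R_{μ-ν,ν}`,
`∂ₜR_{μ,ν} = R_{μ-1,ν}` and `δ_β * R_{μ,ν} = R_{μ+β,ν}`, which gives the diffusion equation for
`R_{1,ν}`; along `x = 2αt^ν` the function `R_{1,ν}` is constant, and the Stefan condition becomes an
equation for `α`.

The denominator `1 - W(-2α; -ν, 1)` is positive because `0 < W(-x; -ν, 1) < 1` for `x > 0`. For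
`ν = 1/2` this is a statement about the error function. For `ν < 1/2` the profile `W(-x; -ν, 1)`
runs from `1` to `0` without extrema at any `x > 0`: at a maximum (up to sign) the function
`R_{1,ν}(x,·)` would be maximal over `(0, 1]` at `t = 1`, so its Caputo derivative would be positive
there (Luchko's extremum principle), whereas its second space derivative is not.

In the Riemann-Liouville case the condition `u(0,t) = 1` determines `φ⁻ * δ_{2ν}`, hence also
`φ⁻ * R_{2ν,ν}(x,·) = φ⁻ * δ_{2ν} * R_{0,ν}(x,·)`. The resulting `u` tends to `W(-2α; -ν, 1) ≠ 0`
along `x = 2αt^ν` as `t → ∞`.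
-/

lemma integrable_of_norm_le_mul_inv_one_add_sq {E : Type*} [NormedAddCommGroup E] {f : ℝ → E}
    {S : Set ℝ} {C : ℝ} (hf : AEStronglyMeasurable f (volume.restrict S)) (hS : MeasurableSet S)
    (hC : ∀ y ∈ S, ‖f y‖ ≤ C * (1 + y ^ 2)⁻¹) : IntegrableOn f S :=
  (integrable_inv_one_add_sq.const_mul C).integrableOn.mono' hf
    ((ae_restrict_mem hS).mono hC)

/-- The closed sector with vertex `p` spanned by the directions `d₁` and `d₂`. -/
def sector (p d₁ d₂ : ℂ) : Set ℂ :=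
  {s | ∃ ρ₁ ρ₂ : ℝ, 0 ≤ ρ₁ ∧ 0 ≤ ρ₂ ∧ s = p + ρ₁ * d₁ + ρ₂ * d₂}

/-- The contour integral of `f` along the ray from `p` in the direction `d`. -/
noncomputable def rayIntegral (f : ℂ → ℂ) (p d : ℂ) : ℂ := ∫ ρ : ℝ in Ioi 0, d * f (p + ρ * d)

section Rotation

variable {f F : ℂ → ℂ} {p d d₁ d₂ : ℂ} {S : Set ℂ}

lemma convex_sector (p d₁ d₂ : ℂ) : Convex ℝ (sector p d₁ d₂) := by
  rintro _ ⟨x₁, x₂, hx₁, hx₂, rfl⟩ _ ⟨y₁, y₂, hy₁, hy₂, rfl⟩ a b ha hb hab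
  refine ⟨a * x₁ + b * y₁, a * x₂ + b * y₂, by positivity, by positivity, ?_⟩
  have hab' : (a : ℂ) + b = 1 := by exact_mod_cast hab
  simp only [Complex.real_smul, Complex.ofReal_add, Complex.ofReal_mul]
  linear_combination p * hab'

lemma left_ray_mem_sector {ρ : ℝ} (hρ : 0 ≤ ρ) : p + ρ * d₁ ∈ sector p d₁ d₂ :=
  ⟨ρ, 0, hρ, le_rfl, by simp⟩

lemma right_ray_mem_sector {ρ : ℝ} (hρ : 0 ≤ ρ) : p + ρ * d₂ ∈ sector p d₁ d₂ :=
  ⟨0, ρ, le_rfl, hρ, by simp⟩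

lemma integrableOn_ray {C : ℝ} (hf : ContinuousOn f S) (hS : ∀ ρ : ℝ, 0 ≤ ρ → p + ρ * d ∈ S)
    (hC : ∀ ρ : ℝ, 0 ≤ ρ → ‖f (p + ρ * d)‖ ≤ C * (1 + ρ ^ 2)⁻¹) :
    IntegrableOn (fun ρ : ℝ => f (p + ρ * d)) (Ioi 0) :=
  integrable_of_norm_le_mul_inv_one_add_sq
    ((hf.comp (by fun_prop) fun ρ hρ => hS ρ (le_of_lt hρ)).aestronglyMeasurable
      measurableSet_Ioi) measurableSet_Ioi fun ρ hρ => hC ρ (le_of_lt hρ)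

lemma tendsto_primitive_along_ray (hF : ∀ s ∈ S, HasDerivWithinAt F (f s) S s)
    (hS : ∀ ρ : ℝ, 0 ≤ ρ → p + ρ * d ∈ S)
    (hint : IntegrableOn (fun ρ : ℝ => f (p + ρ * d)) (Ioi 0)) :
    Tendsto (fun R : ℝ => F (p + R * d)) atTop (𝓝 (F p + rayIntegral f p d)) := by
  have hderiv : ∀ ρ : ℝ, 0 ≤ ρ →
      HasDerivWithinAt (fun ρ : ℝ => F (p + ρ * d)) (d * f (p + ρ * d)) (Ici 0) ρ := fun ρ hρ => by
    have hray : HasDerivAt (fun ρ : ℝ => p + (ρ : ℂ) * d) d ρ := by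
      simpa using ((Complex.ofRealCLM.hasDerivAt (x := ρ)).mul_const d).const_add p
    exact (hF _ (hS ρ hρ)).scomp ρ hray.hasDerivWithinAt fun y hy => hS y hy
  have hderiv' : ∀ ρ ∈ Ioi (0 : ℝ),
      HasDerivAt (fun ρ : ℝ => F (p + ρ * d)) (d * f (p + ρ * d)) ρ := fun ρ hρ =>
    (hderiv ρ (le_of_lt hρ)).hasDerivAt (Ici_mem_nhds hρ)
  have hlim := tendsto_limUnder_of_hasDerivAt_of_integrableOn_Ioi hderiv' (hint.const_mul d)
  have hval := integral_Ioi_of_hasDerivAt_of_tendsto (hderiv 0 le_rfl).continuousWithinAt hderiv'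
    (hint.const_mul d) hlim
  convert hlim using 2
  rw [rayIntegral, hval]
  simp

lemma norm_primitive_sub_le_of_sector_bound
    (hF : ∀ s ∈ sector p d₁ d₂, HasDerivWithinAt F (f s) (sector p d₁ d₂) s) {C : ℝ}
    (hC : ∀ ρ₁ ρ₂ : ℝ, 0 ≤ ρ₁ → 0 ≤ ρ₂ →
      ‖f (p + ρ₁ * d₁ + ρ₂ * d₂)‖ ≤ C * (1 + (ρ₁ + ρ₂) ^ 2)⁻¹) {R : ℝ} (hR : 0 ≤ R) :
    ‖F (p + R * d₂) - F (p + R * d₁)‖ ≤ C * (1 + R ^ 2)⁻¹ * ‖R * (d₂ - d₁)‖ := by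
  have hsub := (convex_sector p d₁ d₂).segment_subset (left_ray_mem_sector hR)
    (right_ray_mem_sector hR)
  have hbound : ∀ s ∈ segment ℝ (p + R * d₁) (p + R * d₂), ‖f s‖ ≤ C * (1 + R ^ 2)⁻¹ := by
    rintro _ ⟨a, b, ha, hb, hab, rfl⟩
    have hab' : (a : ℂ) + b = 1 := by exact_mod_cast hab
    convert hC (a * R) (b * R) (by positivity) (by positivity) using 3
    · simp only [Complex.real_smul, Complex.ofReal_mul]
      linear_combination p * hab'
    · rw [← add_mul, hab, one_mul]
  rw [show R * (d₂ - d₁) = p + R * d₂ - (p + R * d₁) by ring]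
  exact (convex_segment _ _).norm_image_sub_le_of_norm_hasDerivWithin_le
    (fun s hs => (hF s (hsub hs)).mono hsub) hbound (left_mem_segment ℝ _ _)
    (right_mem_segment ℝ _ _)

lemma rayIntegral_eq_of_sector_bound (hf : DifferentiableOn ℂ f (sector p d₁ d₂)) {C : ℝ}
    (hC : ∀ ρ₁ ρ₂ : ℝ, 0 ≤ ρ₁ → 0 ≤ ρ₂ →
      ‖f (p + ρ₁ * d₁ + ρ₂ * d₂)‖ ≤ C * (1 + (ρ₁ + ρ₂) ^ 2)⁻¹) :
    rayIntegral f p d₁ = rayIntegral f p d₂ := by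
  obtain ⟨F, hF⟩ := (convex_sector p d₁ d₂).exists_forall_hasDerivWithinAt hf
  have hlim₁ := tendsto_primitive_along_ray hF (fun ρ hρ => left_ray_mem_sector hρ) <|
    integrableOn_ray hf.continuousOn (fun ρ hρ => left_ray_mem_sector hρ)
      fun ρ hρ => by simpa using hC ρ 0 hρ le_rfl
  have hlim₂ := tendsto_primitive_along_ray hF (fun ρ hρ => right_ray_mem_sector hρ) <|
    integrableOn_ray hf.continuousOn (fun ρ hρ => right_ray_mem_sector hρ)
      fun ρ hρ => by simpa using hC 0 ρ le_rfl hρ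
  have hC0 : 0 ≤ C := by simpa using (norm_nonneg _).trans (hC 0 0 le_rfl le_rfl)
  have hzero : Tendsto (fun R : ℝ => F (p + R * d₂) - F (p + R * d₁)) atTop (𝓝 0) := by
    have hinv : Tendsto (fun R : ℝ => C * ‖d₂ - d₁‖ * R⁻¹) atTop (𝓝 0) := by
      simpa using tendsto_inv_atTop_zero.const_mul (C * ‖d₂ - d₁‖)
    refine squeeze_zero_norm' ?_ hinv
    filter_upwards [eventually_gt_atTop 0] with R hR
    calc ‖F (p + R * d₂) - F (p + R * d₁)‖
        ≤ C * (1 + R ^ 2)⁻¹ * ‖R * (d₂ - d₁)‖ :=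
          norm_primitive_sub_le_of_sector_bound hF hC hR.le
      _ ≤ C * (R ^ 2)⁻¹ * ‖R * (d₂ - d₁)‖ := by gcongr; linarith
      _ = C * ‖d₂ - d₁‖ * R⁻¹ := by
          rw [norm_mul, Complex.norm_real, Real.norm_of_nonneg hR.le]
          field_simp
  have := tendsto_nhds_unique hzero (hlim₂.sub hlim₁)
  linear_combination this

end Rotation

lemma exists_forall_ge_le_of_tendsto {g : ℝ → ℝ} {r₀ l : ℝ} (hg : ContinuousOn g (Ici r₀))
    (hlim : Tendsto g atTop (𝓝 l)) : ∃ C, ∀ r, r₀ ≤ r → g r ≤ C := by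
  obtain ⟨R, hR⟩ := eventually_atTop.mp (hlim.eventually_le_const (lt_add_one l))
  obtain ⟨C, hC⟩ := (isCompact_Icc.image_of_continuousOn
    (hg.mono (Icc_subset_Ici_self : Icc r₀ (max r₀ R) ⊆ _))).bddAbove
  refine ⟨max C (l + 1), fun r hr => ?_⟩
  rcases le_total r (max r₀ R) with h | h
  · exact (hC ⟨r, ⟨hr, h⟩, rfl⟩).trans (le_max_left _ _)
  · exact (hR r ((le_max_right _ _).trans h)).trans (le_max_right _ _)

lemma continuousOn_rpow_const_Ici {r₀ : ℝ} (hr₀ : 0 < r₀) (p : ℝ) :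
    ContinuousOn (fun r : ℝ => r ^ p) (Ici r₀) := fun _ hr =>
  (Real.continuousAt_rpow_const _ _ (Or.inl (hr₀.trans_le hr).ne')).continuousWithinAt

lemma exists_rpow_mul_exp_neg_rpow_le {b ν r₀ : ℝ} (hb : 0 < b) (hν : 0 < ν) (hr₀ : 0 < r₀)
    (p : ℝ) : ∃ C, ∀ r, r₀ ≤ r → r ^ p * Real.exp (-(b * r ^ ν)) ≤ C := by
  refine exists_forall_ge_le_of_tendsto (l := 0) ((continuousOn_rpow_const_Ici hr₀ p).mul
    (continuousOn_const.mul (continuousOn_rpow_const_Ici hr₀ ν)).neg.rexp) ?_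
  refine ((tendsto_rpow_mul_exp_neg_mul_atTop_nhds_zero (p / ν) b hb).comp
    (tendsto_rpow_atTop hν)).congr' ?_
  filter_upwards [eventually_gt_atTop 0] with r hr
  simp only [Function.comp_apply, ← Real.rpow_mul hr.le, mul_div_cancel₀ _ hν.ne', neg_mul]

lemma exists_rpow_mul_exp_rpow_sub_le {b ν r₀ : ℝ} (hb : 0 < b) (hν : ν < 1) (hr₀ : 0 < r₀)
    (p Z : ℝ) : ∃ C, ∀ r, r₀ ≤ r → r ^ p * Real.exp (Z * r ^ ν - b * r) ≤ C := by
  refine exists_forall_ge_le_of_tendsto (l := 0) ((continuousOn_rpow_const_Ici hr₀ p).mul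
    ((continuousOn_const.mul (continuousOn_rpow_const_Ici hr₀ ν)).sub
      (continuousOn_const.mul continuousOn_id)).rexp) ?_
  have hpow : Tendsto (fun r : ℝ => r ^ p * Real.exp (-(b / 2) * r)) atTop (𝓝 0) :=
    tendsto_rpow_mul_exp_neg_mul_atTop_nhds_zero p (b / 2) (half_pos hb)
  have hneg : Tendsto (fun r : ℝ => r * (b / 2 - Z * r ^ (ν - 1))) atTop atTop := by
    refine tendsto_id.atTop_mul_pos (half_pos hb) ?_
    simpa using tendsto_const_nhds.sub
      ((tendsto_rpow_neg_atTop (sub_pos.mpr hν)).const_mul Z)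
  have hprod := hpow.mul (Real.tendsto_exp_neg_atTop_nhds_zero.comp hneg)
  rw [mul_zero] at hprod
  refine hprod.congr' ?_
  filter_upwards [eventually_gt_atTop 0] with r hr
  rw [Function.comp_apply, mul_assoc, ← Real.exp_add, Real.rpow_sub_one hr.ne']
  congr 2
  field_simp
  ring

/-- The integrand `e ^ (s t) s ^ (-μ) e ^ (z s ^ ν)` of the Bromwich and Hankel integrals of the
Wright function; `z = -a` gives the integrand of the function `R_{μ,ν}(a,t)`. -/
noncomputable def wrightKernel (μ ν z t : ℝ) (s : ℂ) : ℂ :=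
  Complex.exp (s * t) * (s ^ (-(μ : ℂ)) * Complex.exp (z * s ^ (ν : ℂ)))

section Kernel

variable {ν : ℝ} {s : ℂ}

lemma norm_wrightKernel (μ ν z t : ℝ) (s : ℂ) :
    ‖wrightKernel μ ν z t s‖ = Real.exp (s.re * t) *
      (‖s‖ ^ (-μ) * Real.exp (z * (‖s‖ ^ ν * Real.cos (s.arg * ν)))) := by
  rw [wrightKernel, norm_mul, norm_mul, Complex.norm_exp, Complex.norm_exp,
    ← Complex.ofReal_neg, Complex.norm_cpow_real, Complex.re_mul_ofReal, Complex.re_ofReal_mul,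
    Complex.cpow_ofReal_re]

lemma hasDerivAt_wrightKernel (μ ν z t : ℝ) (hs : s ∈ Complex.slitPlane) :
    HasDerivAt (wrightKernel μ ν z t)
      (t * wrightKernel μ ν z t s - μ * wrightKernel (μ + 1) ν z t s
        + z * ν * wrightKernel (μ + 1 - ν) ν z t s) s := by
  have hs0 : s ≠ 0 := Complex.slitPlane_ne_zero hs
  have hexp : HasDerivAt (fun s : ℂ => Complex.exp (s * t)) (Complex.exp (s * t) * (1 * t)) s :=
    ((hasDerivAt_id s).mul_const (t : ℂ)).cexp
  have hpow : HasDerivAt (fun s : ℂ => s ^ (-(μ : ℂ))) (-(μ : ℂ) * s ^ (-(μ : ℂ) - 1) * 1) s :=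
    (hasDerivAt_id s).cpow_const hs
  have hexp_pow : HasDerivAt (fun s : ℂ => Complex.exp (z * s ^ (ν : ℂ)))
      (Complex.exp (z * s ^ (ν : ℂ)) * (z * ((ν : ℂ) * s ^ ((ν : ℂ) - 1) * 1))) s :=
    (((hasDerivAt_id s).cpow_const hs).const_mul (z : ℂ)).cexp
  refine (hexp.mul (hpow.mul hexp_pow)).congr_deriv ?_
  have hμ : s ^ (-((μ + 1 : ℝ) : ℂ)) = s ^ (-(μ : ℂ) - 1) := by
    congr 1; push_cast; ring
  have hμν : s ^ (-((μ + 1 - ν : ℝ) : ℂ)) = s ^ (-(μ : ℂ)) * s ^ ((ν : ℂ) - 1) := by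
    rw [← Complex.cpow_add _ _ hs0]; congr 1; push_cast; ring
  simp only [wrightKernel, hμ, hμν, Pi.mul_apply]
  ring

lemma differentiableOn_wrightKernel (μ ν z t : ℝ) :
    DifferentiableOn ℂ (wrightKernel μ ν z t) Complex.slitPlane := fun _ hs =>
  (hasDerivAt_wrightKernel μ ν z t hs).differentiableAt.differentiableWithinAt

lemma wrightKernel_conj (μ ν z t : ℝ) (hs : s ∈ Complex.slitPlane) :
    wrightKernel μ ν z t (conj s) = conj (wrightKernel μ ν z t s) := by
  have hpow : ∀ w : ℝ, conj s ^ (w : ℂ) = conj (s ^ (w : ℂ)) := fun w => by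
    rw [Complex.conj_cpow _ _ (Complex.slitPlane_arg_ne_pi hs), Complex.conj_ofReal]
  simp only [wrightKernel, map_mul, ← Complex.ofReal_neg, hpow, ← Complex.exp_conj,
    Complex.conj_ofReal]

lemma abs_arg_le_three_mul_pi_div_four (h : 0 ≤ s.re + |s.im|) : |s.arg| ≤ 3 * π / 4 := by
  rcases eq_or_ne s 0 with rfl | hs
  · simp only [Complex.arg_zero, abs_zero]
    positivity
  by_contra! hc
  have hle := Complex.abs_arg_le_pi s
  have hneg : Real.cos (|s.arg| - π / 4) < 0 :=
    Real.cos_neg_of_pi_div_two_lt_of_lt (by linarith) (by linarith)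
  have hsin : Real.sin |s.arg| = |s.im| / ‖s‖ := by
    rw [← Real.abs_sin_eq_sin_abs_of_abs_le_pi hle, Complex.sin_arg, abs_div, abs_norm]
  rw [Real.cos_sub, hsin, Real.cos_abs, Complex.cos_arg hs, Real.cos_pi_div_four,
    Real.sin_pi_div_four, ← add_mul, ← add_div] at hneg
  exact hneg.not_ge (by positivity)

lemma cos_three_mul_pi_div_eight_pos : 0 < Real.cos (3 * π / 8) :=
  Real.cos_pos_of_mem_Ioo ⟨by linarith [Real.pi_pos], by linarith [Real.pi_pos]⟩

lemma cos_three_mul_pi_div_eight_le_cos_arg_mul (hν : 0 < ν) (hν' : ν ≤ 1 / 2)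
    (h : 0 ≤ s.re + |s.im|) : Real.cos (3 * π / 8) ≤ Real.cos (s.arg * ν) := by
  have harg := abs_arg_le_three_mul_pi_div_four h
  rw [← Real.cos_abs (s.arg * ν), abs_mul, abs_of_pos hν]
  refine Real.cos_le_cos_of_nonneg_of_le_pi (by positivity) (by linarith [Real.pi_pos]) ?_
  calc |s.arg| * ν ≤ 3 * π / 4 * (1 / 2) := by gcongr
    _ = 3 * π / 8 := by ring

lemma exists_norm_wrightKernel_neg_le (hν : 0 < ν) (hν' : ν ≤ 1 / 2) (μ : ℝ) {a₀ : ℝ}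
    (ha₀ : 0 < a₀) :
    ∃ C c, 0 < c ∧ ∀ a t : ℝ, ∀ s : ℂ, a₀ ≤ a → 1 / 2 ≤ ‖s‖ → 0 ≤ s.re + |s.im| →
      ‖wrightKernel μ ν (-a) t s‖ ≤
        C * Real.exp (-(c * a)) * Real.exp (s.re * t) * (‖s‖ ^ 2)⁻¹ := by
  set κ := Real.cos (3 * π / 8)
  have hκ : 0 < κ := cos_three_mul_pi_div_eight_pos
  obtain ⟨C, hC⟩ := exists_rpow_mul_exp_neg_rpow_le (b := κ / 2 * a₀) (by positivity) hν
    one_half_pos (2 - μ)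
  refine ⟨C, κ / 2 * (1 / 2) ^ ν, by positivity, fun a t s ha hs harg => ?_⟩
  have hs0 : 0 < ‖s‖ := one_half_pos.trans_le hs
  have ha0 : 0 < a := ha₀.trans_le ha
  have hexp : κ / 2 * (1 / 2) ^ ν * a + κ / 2 * a₀ * ‖s‖ ^ ν ≤
      a * (‖s‖ ^ ν * Real.cos (s.arg * ν)) :=
    calc κ / 2 * (1 / 2) ^ ν * a + κ / 2 * a₀ * ‖s‖ ^ ν
        ≤ κ / 2 * ‖s‖ ^ ν * a + κ / 2 * a * ‖s‖ ^ ν := by gcongr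
      _ = a * (‖s‖ ^ ν * κ) := by ring
      _ ≤ a * (‖s‖ ^ ν * Real.cos (s.arg * ν)) := by
          gcongr
          exact cos_three_mul_pi_div_eight_le_cos_arg_mul hν hν' harg
  have hpow : ‖s‖ ^ (-μ) = ‖s‖ ^ (2 - μ) * (‖s‖ ^ 2)⁻¹ := by
    rw [sub_eq_add_neg, Real.rpow_add hs0, Real.rpow_two]
    field_simp
  calc ‖wrightKernel μ ν (-a) t s‖
      ≤ Real.exp (s.re * t) * (‖s‖ ^ (-μ) *
          Real.exp (-(κ / 2 * (1 / 2) ^ ν * a) + -(κ / 2 * a₀ * ‖s‖ ^ ν))) := by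
        rw [norm_wrightKernel]
        gcongr
        linarith
    _ = Real.exp (s.re * t) * (‖s‖ ^ (2 - μ) * Real.exp (-(κ / 2 * a₀ * ‖s‖ ^ ν))) *
          Real.exp (-(κ / 2 * (1 / 2) ^ ν * a)) * (‖s‖ ^ 2)⁻¹ := by
        rw [Real.exp_add, hpow]
        ring
    _ ≤ Real.exp (s.re * t) * C * Real.exp (-(κ / 2 * (1 / 2) ^ ν * a)) * (‖s‖ ^ 2)⁻¹ := by
        gcongr
        exact hC _ hs
    _ = _ := by ring

end Kernel

section Bromwich

variable {ν : ℝ}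

lemma one_add_mul_I_mem_slitPlane (y : ℝ) : 1 + y * Complex.I ∈ Complex.slitPlane :=
  Or.inl (by simp)

lemma sq_norm_one_add_mul_I (y : ℝ) : ‖1 + y * Complex.I‖ ^ 2 = 1 + y ^ 2 := by
  simpa [Complex.normSq_eq_norm_sq] using Complex.normSq_add_mul_I 1 y

lemma one_half_le_norm_one_add_mul_I (y : ℝ) : 1 / 2 ≤ ‖1 + y * Complex.I‖ :=
  calc (1 / 2 : ℝ) ≤ (1 + y * Complex.I).re := by norm_num
    _ ≤ ‖1 + y * Complex.I‖ := Complex.re_le_norm _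

lemma integral_bromwich_re_eq_im_rayIntegral {f : ℂ → ℂ}
    (hconj : ∀ s : ℂ, 0 < s.re → f (conj s) = conj (f s))
    (hint : Integrable fun y : ℝ => f (1 + y * Complex.I)) :
    (∫ y : ℝ, f (1 + y * Complex.I)).re = 2 * (rayIntegral f 1 Complex.I).im := by
  have hneg : ∀ y : ℝ, f (1 + ((-y : ℝ) : ℂ) * Complex.I) = conj (f (1 + y * Complex.I)) :=
    fun y => by
      rw [← hconj _ (by simp)]
      congr 1
      simp
  rw [← integral_add_compl (measurableSet_Ioi (a := (0 : ℝ))) hint, compl_Ioi, ← neg_zero,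
    ← integral_comp_neg_Ioi, neg_zero]
  simp only [hneg, integral_conj, rayIntegral, integral_const_mul, Complex.add_re,
    Complex.conj_re, Complex.I_mul_im]
  ring

lemma continuous_wrightKernel_bromwich (μ ν z t : ℝ) :
    Continuous fun y : ℝ => wrightKernel μ ν z t (1 + y * Complex.I) :=
  (differentiableOn_wrightKernel μ ν z t).continuousOn.comp_continuous (by fun_prop)
    one_add_mul_I_mem_slitPlane

lemma exists_norm_wrightKernel_bromwich_le (hν : 0 < ν) (hν' : ν ≤ 1 / 2) (μ : ℝ) {a₀ : ℝ}
    (ha₀ : 0 < a₀) :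
    ∃ C c, 0 < c ∧ ∀ a t y : ℝ, a₀ ≤ a → ‖wrightKernel μ ν (-a) t (1 + y * Complex.I)‖ ≤
      C * Real.exp (-(c * a)) * Real.exp t * (1 + y ^ 2)⁻¹ := by
  obtain ⟨C, c, hc, hC⟩ := exists_norm_wrightKernel_neg_le hν hν' μ ha₀
  refine ⟨C, c, hc, fun a t y ha => ?_⟩
  have hbound := hC a t (1 + y * Complex.I) ha (one_half_le_norm_one_add_mul_I y)
    (add_nonneg (by simp) (abs_nonneg _))
  rw [sq_norm_one_add_mul_I] at hbound
  simpa using hbound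

lemma integrable_wrightKernel_bromwich (hν : 0 < ν) (hν' : ν ≤ 1 / 2) (μ : ℝ) {a : ℝ}
    (ha : 0 < a) (t : ℝ) :
    Integrable fun y : ℝ => wrightKernel μ ν (-a) t (1 + y * Complex.I) := by
  obtain ⟨C, c, -, hC⟩ := exists_norm_wrightKernel_bromwich_le hν hν' μ ha
  rw [← integrableOn_univ]
  exact integrable_of_norm_le_mul_inv_one_add_sq
    (continuous_wrightKernel_bromwich μ ν (-a) t).aestronglyMeasurable .univ
    fun y _ => hC a t y le_rfl

lemma auxR_zero_left (μ ν t : ℝ) : auxR μ ν 0 t = fracDelta μ t := if_pos rfl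

lemma auxR_eq_integral_bromwich (μ ν : ℝ) {a : ℝ} (ha : 0 < a) (t : ℝ) :
    auxR μ ν a t =
      1 / (2 * π) * (∫ y : ℝ, wrightKernel μ ν (-a) t (1 + y * Complex.I)).re := by
  rw [auxR, if_neg ha.ne', inverseLaplace, ← Complex.re_ofReal_mul]
  simp only [wrightKernel, Complex.ofReal_neg]
  push_cast
  rfl

lemma auxR_eq_im_rayIntegral (hν : 0 < ν) (hν' : ν ≤ 1 / 2) (μ : ℝ) {a : ℝ} (ha : 0 < a)
    (t : ℝ) :
    auxR μ ν a t = 1 / π * (rayIntegral (wrightKernel μ ν (-a) t) 1 Complex.I).im := by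
  rw [auxR_eq_integral_bromwich μ ν ha, integral_bromwich_re_eq_im_rayIntegral
    (fun s hs => wrightKernel_conj μ ν (-a) t (Or.inl hs))
    (integrable_wrightKernel_bromwich hν hν' μ ha t)]
  field_simp

lemma exists_abs_auxR_le (hν : 0 < ν) (hν' : ν ≤ 1 / 2) (μ : ℝ) {a₀ : ℝ} (ha₀ : 0 < a₀) :
    ∃ C c, 0 < c ∧ ∀ a t, a₀ ≤ a → |auxR μ ν a t| ≤ C * Real.exp t * Real.exp (-(c * a)) := by
  obtain ⟨C, c, hc, hC⟩ := exists_norm_wrightKernel_bromwich_le hν hν' μ ha₀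
  refine ⟨1 / (2 * π) * (C * π), c, hc, fun a t ha => ?_⟩
  have hnorm : ‖∫ y : ℝ, wrightKernel μ ν (-a) t (1 + y * Complex.I)‖ ≤
      C * Real.exp (-(c * a)) * Real.exp t * π := by
    rw [← integral_univ_inv_one_add_sq, ← integral_const_mul]
    exact norm_integral_le_of_norm_le (integrable_inv_one_add_sq.const_mul _)
      (Eventually.of_forall fun y => hC a t y ha)
  rw [auxR_eq_integral_bromwich μ ν (ha₀.trans_le ha), abs_mul,
    abs_of_pos (by positivity : 0 < 1 / (2 * π))]
  calc 1 / (2 * π) * |(∫ y : ℝ, wrightKernel μ ν (-a) t (1 + y * Complex.I)).re|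
      ≤ 1 / (2 * π) * (C * Real.exp (-(c * a)) * Real.exp t * π) := by
        gcongr
        exact (Complex.abs_re_le_norm _).trans hnorm
    _ = 1 / (2 * π) * (C * π) * Real.exp t * Real.exp (-(c * a)) := by ring

lemma tendsto_auxR_atTop (hν : 0 < ν) (hν' : ν ≤ 1 / 2) (μ t : ℝ) :
    Tendsto (fun a => auxR μ ν a t) atTop (𝓝 0) := by
  obtain ⟨C, c, hc, hC⟩ := exists_abs_auxR_le hν hν' μ one_pos
  have hexp : Tendsto (fun a => C * Real.exp t * Real.exp (-(c * a))) atTop (𝓝 0) := by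
    simpa using (Real.tendsto_exp_neg_atTop_nhds_zero.comp
      (tendsto_id.const_mul_atTop hc)).const_mul (C * Real.exp t)
  refine squeeze_zero_norm' ?_ hexp
  filter_upwards [eventually_ge_atTop 1] with a ha using hC a t ha

lemma rayIntegral_one_im_eq_zero {f : ℂ → ℂ}
    (hconj : ∀ s : ℂ, 0 < s.re → f (conj s) = conj (f s)) : (rayIntegral f 1 1).im = 0 := by
  have hreal : ∀ ρ ∈ Ioi (0 : ℝ), (1 : ℂ) * f (1 + ρ * 1) = ((f (1 + ρ * 1)).re : ℂ) :=
    fun ρ hρ => by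
      have hpos : 0 < (1 + ρ * 1 : ℂ).re := by
        simpa using add_pos one_pos (mem_Ioi.mp hρ)
      rw [one_mul, eq_comm, ← Complex.conj_eq_iff_re, ← hconj _ hpos]
      simp
  rw [rayIntegral, setIntegral_congr_fun measurableSet_Ioi hreal, integral_complex_ofReal,
    Complex.ofReal_im]

lemma auxR_of_nonpos (hν : 0 < ν) (hν' : ν ≤ 1 / 2) (μ : ℝ) {a : ℝ} (ha : 0 < a) {t : ℝ}
    (ht : t ≤ 0) : auxR μ ν a t = 0 := by
  obtain ⟨C, c, -, hC⟩ := exists_norm_wrightKernel_neg_le hν hν' μ ha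
  have hre : ∀ s ∈ sector 1 Complex.I 1, 1 ≤ s.re := by
    rintro _ ⟨ρ₁, ρ₂, -, hρ₂, rfl⟩
    simpa using hρ₂
  rw [auxR_eq_im_rayIntegral hν hν' μ ha, rayIntegral_eq_of_sector_bound (d₂ := 1)
    (C := |C| * Real.exp (-(c * a)) * 2), rayIntegral_one_im_eq_zero
      fun s hs => wrightKernel_conj μ ν (-a) t (Or.inl hs), mul_zero]
  · exact (differentiableOn_wrightKernel μ ν (-a) t).mono fun s hs =>
      Or.inl (one_pos.trans_le (hre s hs))
  intro ρ₁ ρ₂ hρ₁ hρ₂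
  set s : ℂ := 1 + ρ₁ * Complex.I + ρ₂ * 1 with hs
  have hs1 : 1 ≤ s.re := hre s ⟨ρ₁, ρ₂, hρ₁, hρ₂, hs⟩
  have hnorm : (1 + (ρ₁ + ρ₂) ^ 2) / 2 ≤ ‖s‖ ^ 2 := by
    rw [← Complex.normSq_eq_norm_sq, Complex.normSq_apply]
    simp only [hs, Complex.add_re, Complex.add_im, Complex.mul_re, Complex.mul_im,
      Complex.ofReal_re, Complex.ofReal_im, Complex.I_re, Complex.I_im, Complex.one_re,
      Complex.one_im]
    nlinarith [sq_nonneg (ρ₁ - ρ₂)]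
  calc ‖wrightKernel μ ν (-a) t s‖
      ≤ C * Real.exp (-(c * a)) * Real.exp (s.re * t) * (‖s‖ ^ 2)⁻¹ :=
        hC a t s le_rfl (by linarith [Complex.re_le_norm s])
          (add_nonneg (by linarith) (abs_nonneg _))
    _ ≤ |C| * Real.exp (-(c * a)) * 1 * ((1 + (ρ₁ + ρ₂) ^ 2) / 2)⁻¹ := by
        gcongr
        · exact le_abs_self C
        · exact Real.exp_le_one_iff.mpr (mul_nonpos_of_nonneg_of_nonpos (by linarith) ht)
    _ = |C| * Real.exp (-(c * a)) * 2 * (1 + (ρ₁ + ρ₂) ^ 2)⁻¹ := by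
        rw [inv_div]
        ring

end Bromwich

section GammaDistribution

open ProbabilityTheory

variable {a r : ℝ}

lemma integrable_gammaPDFReal (ha : 0 < a) (hr : 0 < r) : Integrable (gammaPDFReal a r) :=
  ⟨(stronglyMeasurable_gammaPDFReal a r).aestronglyMeasurable,
    (hasFiniteIntegral_iff_ofReal (Eventually.of_forall (gammaPDFReal_nonneg ha hr))).mpr
      ((lintegral_gammaPDF_eq_one ha hr).trans_lt ENNReal.one_lt_top)⟩

lemma integral_gammaPDFReal (ha : 0 < a) (hr : 0 < r) : ∫ x, gammaPDFReal a r x = 1 := by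
  rw [integral_eq_lintegral_of_nonneg_ae (Eventually.of_forall (gammaPDFReal_nonneg ha hr))
    (stronglyMeasurable_gammaPDFReal a r).aestronglyMeasurable]
  exact congrArg ENNReal.toReal (lintegral_gammaPDF_eq_one ha hr)

lemma measurable_gammaPDF : Measurable (gammaPDF a r) :=
  (measurable_gammaPDFReal a r).ennreal_ofReal

lemma integral_gammaMeasure {E : Type*} [NormedAddCommGroup E] [NormedSpace ℝ E]
    (ha : 0 < a) (hr : 0 < r) (g : ℝ → E) :
    ∫ x, g x ∂gammaMeasure a r = ∫ x, gammaPDFReal a r x • g x := by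
  rw [gammaMeasure, integral_withDensity_eq_integral_toReal_smul measurable_gammaPDF
    (Eventually.of_forall fun _ => ENNReal.ofReal_lt_top)]
  simp only [gammaPDF, ENNReal.toReal_ofReal (gammaPDFReal_nonneg ha hr _)]

lemma gammaPDFReal_mul_exp (hr : 0 < r) {t : ℝ} (ht : t < r) (x : ℝ) :
    gammaPDFReal a r x * Real.exp (t * x) = (r / (r - t)) ^ a * gammaPDFReal a (r - t) x := by
  have hrt : 0 < r - t := sub_pos.mpr ht
  simp only [gammaPDFReal]
  split_ifs
  · rw [mul_assoc, ← Real.exp_add, Real.div_rpow hr.le hrt.le]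
    field_simp
    ring_nf
  · simp

lemma integrable_exp_mul_gammaMeasure (ha : 0 < a) (hr : 0 < r) {t : ℝ} (ht : t < r) :
    Integrable (fun x => Real.exp (t * x)) (gammaMeasure a r) := by
  rw [gammaMeasure, integrable_withDensity_iff_integrable_smul' measurable_gammaPDF
    (Eventually.of_forall fun _ => ENNReal.ofReal_lt_top)]
  simp only [gammaPDF, ENNReal.toReal_ofReal (gammaPDFReal_nonneg ha hr _), smul_eq_mul,
    gammaPDFReal_mul_exp hr ht]
  exact (integrable_gammaPDFReal ha (sub_pos.mpr ht)).const_mul _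

lemma mgf_gammaMeasure (ha : 0 < a) (hr : 0 < r) {t : ℝ} (ht : t < r) :
    mgf id (gammaMeasure a r) t = (1 - t / r) ^ (-a) := by
  simp only [mgf, id, integral_gammaMeasure ha hr, smul_eq_mul, gammaPDFReal_mul_exp hr ht]
  rw [integral_const_mul, integral_gammaPDFReal ha (sub_pos.mpr ht), mul_one, one_sub_div hr.ne',
    Real.rpow_neg (div_nonneg (sub_pos.mpr ht).le hr.le),
    ← Real.inv_rpow (div_nonneg (sub_pos.mpr ht).le hr.le), inv_div]

lemma complexMGF_gammaMeasure (ha : 0 < a) (hr : 0 < r) {z : ℂ} (hz : z.re < r) :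
    complexMGF id (gammaMeasure a r) z = (1 - z / r) ^ (-a : ℂ) := by
  have hre : ∀ z : ℂ, z.re < r → 0 < (1 - z / r).re := fun z hz => by
    simpa using (div_lt_one hr).mpr hz
  have hopen : IsOpen {z : ℂ | z.re < r} := isOpen_lt Complex.continuous_re continuous_const
  have hmgf : AnalyticOnNhd ℂ (complexMGF id (gammaMeasure a r)) {z : ℂ | z.re < r} :=
    analyticOnNhd_complexMGF.mono fun z hz => interior_maximal
      (fun _ ht => integrable_exp_mul_gammaMeasure ha hr ht) isOpen_Iio hz
  have hpow : AnalyticOnNhd ℂ (fun z : ℂ => (1 - z / r) ^ (-a : ℂ)) {z : ℂ | z.re < r} :=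
    DifferentiableOn.analyticOnNhd (fun z hz => by
      have hbase : DifferentiableAt ℂ (fun z : ℂ => 1 - z / r) z := by fun_prop
      exact (hbase.cpow_const (Or.inl (hre z hz))).differentiableWithinAt) hopen
  refine hmgf.eqOn_of_preconnected_of_frequently_eq hpow
    (convex_halfSpace_re_lt r).isPreconnected (z₀ := ((0 : ℝ) : ℂ)) (by simpa using hr) ?_ hz
  have hreal : ∀ᶠ t : ℝ in 𝓝[≠] 0,
      complexMGF id (gammaMeasure a r) t = (1 - (t : ℂ) / r) ^ (-a : ℂ) := by
    filter_upwards [nhdsWithin_le_nhds (Iio_mem_nhds hr)] with t ht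
    rw [complexMGF_ofReal, mgf_gammaMeasure ha hr ht,
      Complex.ofReal_cpow (by simpa using ((div_lt_one hr).mpr ht).le)]
    push_cast
    rfl
  exact (Complex.continuous_ofReal.continuousAt.continuousWithinAt.tendsto_nhdsWithin
    fun t ht => by simpa using ht).frequently hreal.frequently

lemma fourier_gammaPDFReal (ha : 0 < a) (hr : 0 < r) (w : ℝ) :
    FourierTransform.fourier (fun x => (gammaPDFReal a r x : ℂ)) w =
      (1 + (2 * π * w : ℝ) / r * Complex.I) ^ (-a : ℂ) := by
  have hmgf := complexMGF_gammaMeasure ha hr (z := -(2 * π * w : ℝ) * Complex.I)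
    (by simpa [Complex.mul_re] using hr)
  rw [complexMGF, integral_gammaMeasure ha hr] at hmgf
  have hintegrand : ∀ x : ℝ, Complex.exp ((-2 * π * x * w : ℝ) * Complex.I) •
      (gammaPDFReal a r x : ℂ) =
        gammaPDFReal a r x • Complex.exp (-(2 * π * w : ℝ) * Complex.I * (id x : ℝ)) := fun x => by
    rw [smul_eq_mul, mul_comm, Complex.real_smul, id]
    push_cast
    ring_nf
  rw [Real.fourier_real_eq_integral_exp_smul]
  simp only [hintegrand]
  rw [hmgf]
  ring_nf

end GammaDistribution

section InversePower

lemma integrable_cpow_bromwich {μ : ℝ} (hμ : 2 ≤ μ) :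
    Integrable fun y : ℝ => (1 + y * Complex.I) ^ (-μ : ℂ) := by
  have hcont : Continuous fun y : ℝ => (1 + y * Complex.I) ^ (-μ : ℂ) :=
    Continuous.cpow (by fun_prop) continuous_const one_add_mul_I_mem_slitPlane
  rw [← integrableOn_univ]
  refine integrable_of_norm_le_mul_inv_one_add_sq (C := 1) hcont.aestronglyMeasurable .univ
    fun y _ => ?_
  have hone : 1 ≤ ‖1 + y * Complex.I‖ := by
    simpa using Complex.re_le_norm (1 + y * Complex.I)
  rw [← Complex.ofReal_neg, Complex.norm_cpow_real, one_mul, ← sq_norm_one_add_mul_I,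
    ← Real.rpow_two, ← Real.rpow_neg (norm_nonneg _)]
  exact Real.rpow_le_rpow_of_exponent_le hone (by linarith)

lemma wrightKernel_zero_bromwich (μ ν t y : ℝ) :
    wrightKernel μ ν 0 t (1 + y * Complex.I) =
      Real.exp t * (Complex.exp (y * t * Complex.I) * (1 + y * Complex.I) ^ (-μ : ℂ)) := by
  rw [wrightKernel, Complex.ofReal_zero, zero_mul, Complex.exp_zero, mul_one, ← mul_assoc,
    Complex.ofReal_exp, ← Complex.exp_add]
  ring_nf

lemma integrable_wrightKernel_zero_bromwich {μ : ℝ} (hμ : 2 ≤ μ) (ν t : ℝ) :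
    Integrable fun y : ℝ => wrightKernel μ ν 0 t (1 + y * Complex.I) := by
  simp only [wrightKernel_zero_bromwich]
  refine ((integrable_cpow_bromwich hμ).bdd_mul (c := 1) (by fun_prop)
    (Eventually.of_forall fun y => ?_)).const_mul _
  rw [← Complex.ofReal_mul, Complex.norm_exp_ofReal_mul_I]

open ProbabilityTheory in
/-- Fourier inversion, applied to the density of the Gamma distribution. -/
lemma integral_exp_mul_cpow_bromwich {μ : ℝ} (hμ : 2 ≤ μ) {t : ℝ} (ht : 0 < t) :
    ∫ y : ℝ, Complex.exp (y * t * Complex.I) * (1 + y * Complex.I) ^ (-μ : ℂ) =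
      (2 * π * gammaPDFReal μ 1 t : ℝ) := by
  have hμ0 : 0 < μ := by linarith
  set g : ℝ → ℂ := fun y => Complex.exp (y * t * Complex.I) * (1 + y * Complex.I) ^ (-μ : ℂ)
  have hfourier : FourierTransform.fourier (fun x => (gammaPDFReal μ 1 x : ℂ)) =
      fun w => (1 + (2 * π * w : ℝ) * Complex.I) ^ (-μ : ℂ) :=
    funext fun w => by simp [fourier_gammaPDFReal hμ0 one_pos]
  have hcont : ContinuousAt (fun x => (gammaPDFReal μ 1 x : ℂ)) t := by
    have hformula : ContinuousAt
        (fun x : ℝ => 1 ^ μ / Real.Gamma μ * x ^ (μ - 1) * Real.exp (-(1 * x))) t :=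
      (continuousAt_const.mul (Real.continuousAt_rpow_const _ _ (Or.inl ht.ne'))).mul
        (by fun_prop)
    refine Complex.continuous_ofReal.continuousAt.comp (hformula.congr ?_)
    filter_upwards [Ioi_mem_nhds ht] with x hx
    rw [gammaPDFReal, if_pos (le_of_lt hx)]
  have hinv := (integrable_gammaPDFReal hμ0 one_pos).ofReal.fourierInv_fourier_eq
    (hfourier ▸ (integrable_cpow_bromwich hμ).comp_mul_left' (by positivity)) hcont
  have hphase : ∀ w : ℝ, Complex.exp ((-2 * π * w * -t : ℝ) * Complex.I) •
      (1 + (2 * π * w : ℝ) * Complex.I) ^ (-μ : ℂ) = g (2 * π * w) := fun w => by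
    simp only [g, smul_eq_mul]
    congr 2
    push_cast
    ring
  rw [hfourier, Real.fourierInv_eq_fourier_neg, Real.fourier_real_eq_integral_exp_smul] at hinv
  simp only [hphase] at hinv
  rw [Measure.integral_comp_mul_left g, abs_of_pos (by positivity), Complex.real_smul] at hinv
  rw [Complex.ofReal_mul, ← hinv, Complex.ofReal_inv, mul_inv_cancel_left₀]
  exact Complex.ofReal_ne_zero.mpr (by positivity)

lemma integral_wrightKernel_zero_bromwich {μ : ℝ} (hμ : 2 ≤ μ) (ν : ℝ) {t : ℝ} (ht : 0 < t) :
    ∫ y : ℝ, wrightKernel μ ν 0 t (1 + y * Complex.I) = (2 * π * fracDelta μ t : ℝ) := by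
  simp only [wrightKernel_zero_bromwich]
  rw [integral_const_mul, integral_exp_mul_cpow_bromwich hμ ht, ← Complex.ofReal_mul,
    ProbabilityTheory.gammaPDFReal, if_pos ht.le, fracDelta, Real.one_rpow, one_mul, Real.exp_neg]
  congr 1
  field_simp

end InversePower

section Hankel

variable {ν : ℝ}

lemma hankel_sector_mem_slitPlane {ρ₁ ρ₂ : ℝ} (hρ₁ : 0 ≤ ρ₁) (hρ₂ : 0 ≤ ρ₂) :
    1 + ρ₁ * Complex.I + ρ₂ * (-1 + Complex.I) ∈ Complex.slitPlane := by
  rw [Complex.mem_slitPlane_iff]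
  rcases hρ₂.eq_or_lt with rfl | h
  · left; simp
  · right; simpa using (add_pos_of_nonneg_of_pos hρ₁ h).ne'

lemma hankel_ray_mem_slitPlane {ρ : ℝ} (hρ : 0 ≤ ρ) :
    1 + ρ * (-1 + Complex.I) ∈ Complex.slitPlane := by
  simpa using hankel_sector_mem_slitPlane le_rfl hρ

lemma sq_norm_hankel_sector (ρ₁ ρ₂ : ℝ) :
    ‖1 + ρ₁ * Complex.I + ρ₂ * (-1 + Complex.I)‖ ^ 2 = (1 - ρ₂) ^ 2 + (ρ₁ + ρ₂) ^ 2 := by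
  rw [← Complex.normSq_eq_norm_sq, Complex.normSq_apply]
  simp only [Complex.add_re, Complex.one_re, Complex.mul_re, Complex.ofReal_re, Complex.I_re,
    mul_zero, Complex.ofReal_im, Complex.I_im, mul_one, sub_self, add_zero, Complex.neg_re, mul_neg,
    Complex.add_im, Complex.neg_im, Complex.one_im, neg_zero, zero_add, sub_zero, Complex.mul_im]
  ring

lemma one_add_sq_div_four_le_sq_norm_hankel_sector {ρ₁ ρ₂ : ℝ} (hρ₁ : 0 ≤ ρ₁) (hρ₂ : 0 ≤ ρ₂) :
    (1 + (ρ₁ + ρ₂) ^ 2) / 4 ≤ ‖1 + ρ₁ * Complex.I + ρ₂ * (-1 + Complex.I)‖ ^ 2 := by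
  rw [sq_norm_hankel_sector]
  nlinarith [sq_nonneg (7 * ρ₂ - 4), mul_nonneg hρ₁ hρ₂, sq_nonneg ρ₁]

lemma one_half_le_norm_hankel_sector {ρ₁ ρ₂ : ℝ} (hρ₁ : 0 ≤ ρ₁) (hρ₂ : 0 ≤ ρ₂) :
    1 / 2 ≤ ‖1 + ρ₁ * Complex.I + ρ₂ * (-1 + Complex.I)‖ := by
  have := one_add_sq_div_four_le_sq_norm_hankel_sector hρ₁ hρ₂
  refine le_of_sq_le_sq ?_ (norm_nonneg _)
  nlinarith [sq_nonneg (ρ₁ + ρ₂)]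

lemma one_half_le_norm_hankel_ray {ρ : ℝ} (hρ : 0 ≤ ρ) :
    1 / 2 ≤ ‖1 + ρ * (-1 + Complex.I)‖ := by
  simpa using one_half_le_norm_hankel_sector le_rfl hρ

lemma norm_hankel_ray_le {ρ : ℝ} (hρ : 0 ≤ ρ) : ‖1 + ρ * (-1 + Complex.I)‖ ≤ 1 + 2 * ρ := by
  refine le_of_sq_le_sq ?_ (by positivity)
  have := sq_norm_hankel_sector 0 ρ
  simp only [Complex.ofReal_zero, zero_mul, add_zero, zero_add] at this
  rw [this]
  nlinarith

lemma rayIntegral_I_eq_hankel {f : ℂ → ℂ} (hf : DifferentiableOn ℂ f Complex.slitPlane) {C : ℝ}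
    (hC : ∀ s : ℂ, s.re ≤ 1 → 1 / 2 ≤ ‖s‖ → 0 ≤ s.re + |s.im| → ‖f s‖ ≤ C * (‖s‖ ^ 2)⁻¹) :
    rayIntegral f 1 Complex.I = rayIntegral f 1 (-1 + Complex.I) := by
  have hC0 : 0 ≤ C := by
    simpa using (norm_nonneg _).trans (hC 1 (by simp) (by norm_num) (by simp))
  refine rayIntegral_eq_of_sector_bound (C := C * 4) (hf.mono ?_) fun ρ₁ ρ₂ hρ₁ hρ₂ => ?_
  · rintro _ ⟨ρ₁, ρ₂, hρ₁, hρ₂, rfl⟩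
    exact hankel_sector_mem_slitPlane hρ₁ hρ₂
  have hre : (1 + ρ₁ * Complex.I + ρ₂ * (-1 + Complex.I)).re = 1 - ρ₂ := by
    simp [sub_eq_add_neg]
  have him : (1 + ρ₁ * Complex.I + ρ₂ * (-1 + Complex.I)).im = ρ₁ + ρ₂ := by simp
  refine (hC _ (by rw [hre]; linarith) (one_half_le_norm_hankel_sector hρ₁ hρ₂) ?_).trans ?_
  · rw [hre, him, abs_of_nonneg (add_nonneg hρ₁ hρ₂)]
    linarith
  · rw [mul_assoc, show 4 * (1 + (ρ₁ + ρ₂) ^ 2)⁻¹ = ((1 + (ρ₁ + ρ₂) ^ 2) / 4)⁻¹ by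
      rw [inv_div, div_eq_mul_inv]]
    gcongr
    exact one_add_sq_div_four_le_sq_norm_hankel_sector hρ₁ hρ₂

/-- The Hankel integral `(1 / 2πi) ∫ e ^ (s t) s ^ (-μ) e ^ (z s ^ ν) ds` over the ray from `1` in
the direction `-1 + i` and its complex conjugate; by symmetry the upper ray suffices. -/
noncomputable def hankelIntegral (μ ν z t : ℝ) : ℝ :=
  1 / π * (rayIntegral (wrightKernel μ ν z t) 1 (-1 + Complex.I)).im

lemma exists_hankel_majorant_le (hν : ν < 1) (μ Z : ℝ) {t : ℝ} (ht : 0 < t) :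
    ∃ C, ∀ ρ : ℝ, 0 ≤ ρ →
      Real.exp ((1 - ρ) * t) * (‖1 + ρ * (-1 + Complex.I)‖ ^ (-μ) *
        Real.exp (Z * ‖1 + ρ * (-1 + Complex.I)‖ ^ ν)) ≤ C * (1 + ρ ^ 2)⁻¹ := by
  obtain ⟨C, hC⟩ := exists_rpow_mul_exp_rpow_sub_le (half_pos ht) hν one_half_pos (2 - μ) Z
  refine ⟨Real.exp (3 / 2 * t) * C * 4, fun ρ hρ => ?_⟩
  set r := ‖1 + ρ * (-1 + Complex.I)‖
  have hr : 1 / 2 ≤ r := one_half_le_norm_hankel_ray hρ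
  have hr0 : 0 < r := one_half_pos.trans_le hr
  have hC0 : 0 ≤ C := le_trans (by positivity) (hC r hr)
  have hsq : (1 + ρ ^ 2) / 4 ≤ r ^ 2 := by
    simpa [r] using one_add_sq_div_four_le_sq_norm_hankel_sector le_rfl hρ
  have hexp : (1 - ρ) * t ≤ 3 / 2 * t + -(t / 2 * r) := by
    nlinarith [norm_hankel_ray_le hρ]
  calc Real.exp ((1 - ρ) * t) * (r ^ (-μ) * Real.exp (Z * r ^ ν))
      ≤ Real.exp (3 / 2 * t + -(t / 2 * r)) * (r ^ (-μ) * Real.exp (Z * r ^ ν)) := by gcongr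
    _ = Real.exp (3 / 2 * t) * (r ^ (2 - μ) * Real.exp (Z * r ^ ν - t / 2 * r)) *
          (r ^ 2)⁻¹ := by
        rw [sub_eq_add_neg 2, Real.rpow_add hr0, Real.rpow_two, sub_eq_add_neg, Real.exp_add,
          Real.exp_add]
        field_simp
    _ ≤ Real.exp (3 / 2 * t) * C * ((1 + ρ ^ 2) / 4)⁻¹ := by
        gcongr
        exact hC r hr
    _ = _ := by field_simp

lemma norm_wrightKernel_hankel_ray_le (μ ν z t ρ : ℝ) :
    ‖wrightKernel μ ν z t (1 + ρ * (-1 + Complex.I))‖ ≤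
      Real.exp ((1 - ρ) * t) * (‖1 + ρ * (-1 + Complex.I)‖ ^ (-μ) *
        Real.exp (|z| * ‖1 + ρ * (-1 + Complex.I)‖ ^ ν)) := by
  set s : ℂ := 1 + ρ * (-1 + Complex.I) with hs
  have hre : s.re = 1 - ρ := by simp [hs, sub_eq_add_neg]
  have hcos : z * (‖s‖ ^ ν * Real.cos (s.arg * ν)) ≤ |z| * ‖s‖ ^ ν := by
    refine (le_abs_self _).trans ?_
    rw [abs_mul, abs_mul, abs_of_nonneg (by positivity : 0 ≤ ‖s‖ ^ ν)]
    gcongr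
    exact mul_le_of_le_one_right (by positivity) (Real.abs_cos_le_one _)
  rw [norm_wrightKernel, hre]
  gcongr

lemma exists_norm_wrightKernel_hankel_le (hν : ν < 1) (μ z : ℝ) {t : ℝ} (ht : 0 < t) :
    ∃ C, ∀ ρ : ℝ, 0 ≤ ρ →
      ‖wrightKernel μ ν z t (1 + ρ * (-1 + Complex.I))‖ ≤ C * (1 + ρ ^ 2)⁻¹ :=
  (exists_hankel_majorant_le hν μ |z| ht).imp fun _ hC ρ hρ =>
    (norm_wrightKernel_hankel_ray_le μ ν z t ρ).trans (hC ρ hρ)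

lemma continuousOn_wrightKernel_hankel_ray (μ ν z t : ℝ) :
    ContinuousOn (fun ρ : ℝ => wrightKernel μ ν z t (1 + ρ * (-1 + Complex.I))) (Ici 0) :=
  (differentiableOn_wrightKernel μ ν z t).continuousOn.comp (by fun_prop)
    fun _ hρ => hankel_ray_mem_slitPlane hρ

lemma integrableOn_wrightKernel_hankel_ray (hν : ν < 1) (μ z : ℝ) {t : ℝ} (ht : 0 < t) :
    IntegrableOn (fun ρ : ℝ => wrightKernel μ ν z t (1 + ρ * (-1 + Complex.I))) (Ioi 0) := by
  obtain ⟨C, hC⟩ := exists_norm_wrightKernel_hankel_le hν μ z ht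
  exact integrableOn_ray (differentiableOn_wrightKernel μ ν z t).continuousOn
    (fun ρ hρ => hankel_ray_mem_slitPlane hρ) hC

lemma auxR_eq_hankelIntegral (hν : 0 < ν) (hν' : ν ≤ 1 / 2) (μ : ℝ) {a t : ℝ}
    (ha : 0 < a) (ht : 0 ≤ t) : auxR μ ν a t = hankelIntegral μ ν (-a) t := by
  obtain ⟨C, c, -, hC⟩ := exists_norm_wrightKernel_neg_le hν hν' μ ha
  rw [auxR_eq_im_rayIntegral hν hν' μ ha, hankelIntegral,
    rayIntegral_I_eq_hankel (C := |C| * Real.exp (-(c * a)) * Real.exp t)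
      (differentiableOn_wrightKernel μ ν (-a) t)]
  intro s hre hs harg
  refine (hC a t s le_rfl hs harg).trans ?_
  gcongr
  · exact le_abs_self C
  · nlinarith

/-- Integration by parts. -/
lemma hankelIntegral_recurrence (hν : ν < 1) (μ z : ℝ) {t : ℝ} (ht : 0 < t) :
    t * hankelIntegral μ ν z t - μ * hankelIntegral (μ + 1) ν z t
      + z * ν * hankelIntegral (μ + 1 - ν) ν z t = 0 := by
  set d : ℂ := -1 + Complex.I with hd
  have hint : ∀ μ', IntegrableOn (fun ρ : ℝ => d * wrightKernel μ' ν z t (1 + ρ * d)) (Ioi 0) :=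
    fun μ' => (integrableOn_wrightKernel_hankel_ray hν μ' z ht).const_mul d
  have hderiv : ∀ ρ ∈ Ioi (0 : ℝ), HasDerivAt (fun ρ : ℝ => wrightKernel μ ν z t (1 + ρ * d))
      ((t : ℂ) * (d * wrightKernel μ ν z t (1 + ρ * d))
        - (μ : ℂ) * (d * wrightKernel (μ + 1) ν z t (1 + ρ * d))
        + ((z * ν : ℝ) : ℂ) * (d * wrightKernel (μ + 1 - ν) ν z t (1 + ρ * d))) ρ :=
    fun ρ hρ => by
      have hray : HasDerivAt (fun ρ : ℝ => 1 + (ρ : ℂ) * d) d ρ := by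
        simpa using ((Complex.ofRealCLM.hasDerivAt (x := ρ)).mul_const d).const_add 1
      refine ((hasDerivAt_wrightKernel μ ν z t
        (hankel_ray_mem_slitPlane (le_of_lt hρ))).scomp ρ hray).congr_deriv ?_
      rw [smul_eq_mul]
      push_cast
      ring
  have hlim : Tendsto (fun ρ : ℝ => wrightKernel μ ν z t (1 + ρ * d)) atTop (𝓝 0) := by
    obtain ⟨C, hC⟩ := exists_norm_wrightKernel_hankel_le hν μ z ht
    have hinv : Tendsto (fun ρ : ℝ => C * (1 + ρ ^ 2)⁻¹) atTop (𝓝 0) := by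
      simpa using (tendsto_atTop_add_const_left _ (1 : ℝ)
        (tendsto_pow_atTop two_ne_zero)).inv_tendsto_atTop.const_mul C
    refine squeeze_zero_norm' ?_ hinv
    filter_upwards [eventually_ge_atTop 0] with ρ hρ using hC ρ hρ
  have hreal : (wrightKernel μ ν z t (1 + (0 : ℝ) * d)).im = 0 := by
    rw [← Complex.conj_eq_iff_im, ← wrightKernel_conj _ _ _ _ (hankel_ray_mem_slitPlane le_rfl)]
    simp
  have hparts := integral_Ioi_of_hasDerivAt_of_tendsto
    (continuousOn_wrightKernel_hankel_ray μ ν z t 0 self_mem_Ici) hderiv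
    ((((hint μ).const_mul _).sub ((hint (μ + 1)).const_mul _)).add
      ((hint (μ + 1 - ν)).const_mul _)) hlim
  rw [integral_add (by exact ((hint μ).const_mul _).sub ((hint (μ + 1)).const_mul _))
      ((hint (μ + 1 - ν)).const_mul _), integral_sub ((hint μ).const_mul _)
      ((hint (μ + 1)).const_mul _), integral_const_mul (t : ℂ),
    integral_const_mul (μ : ℂ), integral_const_mul ((z * ν : ℝ) : ℂ)] at hparts
  have him := congrArg Complex.im hparts
  simp only [Complex.add_im, Complex.sub_im, Complex.im_ofReal_mul, zero_sub, Complex.neg_im,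
    ← hd, hreal, neg_zero] at him
  simp only [hankelIntegral, rayIntegral, ← hd]
  linear_combination (1 / π) * him

lemma fracDelta_eq_mul_fracDelta_add_one_div (μ : ℝ) {t : ℝ} (ht : 0 < t) :
    fracDelta μ t = μ * fracDelta (μ + 1) t / t := by
  rw [fracDelta, fracDelta, add_sub_cancel_right, Real.rpow_sub_one ht.ne']
  rcases eq_or_ne μ 0 with rfl | hμ
  · simp
  · rw [Real.Gamma_add_one hμ, ← mul_div_assoc, mul_div_mul_left _ _ hμ, div_right_comm]

lemma hankelIntegral_zero_of_two_le {μ : ℝ} (hμ : 2 ≤ μ) {t : ℝ} (ht : 0 < t) :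
    hankelIntegral μ ν 0 t = fracDelta μ t := by
  have hconj : ∀ s : ℂ, 0 < s.re → wrightKernel μ ν 0 t (conj s) = conj (wrightKernel μ ν 0 t s) :=
    fun s hs => wrightKernel_conj μ ν 0 t (Or.inl hs)
  have hre := integral_bromwich_re_eq_im_rayIntegral hconj
    (integrable_wrightKernel_zero_bromwich hμ ν t)
  rw [integral_wrightKernel_zero_bromwich hμ ν ht, Complex.ofReal_re,
    rayIntegral_I_eq_hankel (C := Real.exp t * (1 / 2) ^ (2 - μ))
      (differentiableOn_wrightKernel μ ν 0 t)] at hre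
  · rw [hankelIntegral]
    field_simp
    linarith
  intro s hsre hs _
  have hs0 : 0 < ‖s‖ := one_half_pos.trans_le hs
  calc ‖wrightKernel μ ν 0 t s‖ = Real.exp (s.re * t) * ‖s‖ ^ (2 - μ) * (‖s‖ ^ 2)⁻¹ := by
        rw [norm_wrightKernel, zero_mul, Real.exp_zero, mul_one, sub_eq_add_neg,
          Real.rpow_add hs0, Real.rpow_two]
        field_simp
    _ ≤ Real.exp t * (1 / 2) ^ (2 - μ) * (‖s‖ ^ 2)⁻¹ := by
        have hpow : ‖s‖ ^ (2 - μ) ≤ (1 / 2) ^ (2 - μ) :=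
          Real.rpow_le_rpow_of_nonpos one_half_pos hs (by linarith)
        gcongr
        nlinarith

lemma hankelIntegral_zero (hν : ν < 1) (μ : ℝ) {t : ℝ} (ht : 0 < t) :
    hankelIntegral μ ν 0 t = fracDelta μ t := by
  have hdescent : ∀ n : ℕ, ∀ μ : ℝ, 2 - (n : ℝ) ≤ μ → hankelIntegral μ ν 0 t = fracDelta μ t := by
    intro n
    induction n with
    | zero => exact fun μ hμ => hankelIntegral_zero_of_two_le (by simpa using hμ) ht
    | succ n ih =>
      intro μ hμ
      push_cast at hμ
      have hrec := hankelIntegral_recurrence hν μ 0 ht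
      rw [fracDelta_eq_mul_fracDelta_add_one_div μ ht, eq_div_iff ht.ne',
        ← ih (μ + 1) (by linarith)]
      linear_combination hrec
  obtain ⟨n, hn⟩ := exists_nat_ge (2 - μ)
  exact hdescent n μ (by linarith)

end Hankel

section PowerSeries

variable {c : ℕ → ℝ} {f g : ℝ → ℝ}

lemma hasFPowerSeriesOnBall_of_hasSum_pow (hf : ∀ z, HasSum (fun n => c n * z ^ n) (f z)) :
    HasFPowerSeriesOnBall f (FormalMultilinearSeries.ofScalars ℝ c) 0 ⊤ where
  r_le := by
    refine (FormalMultilinearSeries.radius_eq_top_of_summable_norm _ fun r => ?_).ge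
    simpa using (hf r).summable.norm
  r_pos := ENNReal.zero_lt_top
  hasSum := fun {y} _ => by simpa [FormalMultilinearSeries.ofScalars_apply_eq, mul_comm] using hf y

lemma hasDerivAt_of_hasSum_pow (hf : ∀ z, HasSum (fun n => c n * z ^ n) (f z))
    (hg : ∀ z, HasSum (fun n => (n + 1) * c (n + 1) * z ^ n) (g z)) (z : ℝ) :
    HasDerivAt f (g z) z := by
  have hball := hasFPowerSeriesOnBall_of_hasSum_pow hf
  have hfderiv : HasSum
      (fun n => (FormalMultilinearSeries.ofScalars ℝ c).derivSeries n (fun _ => z) 1)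
      (fderiv ℝ f z 1) := by
    simpa using (hball.fderiv.hasSum (y := z) (by simp)).mapL (ContinuousLinearMap.apply ℝ ℝ 1)
  have hval : fderiv ℝ f z 1 = g z := hfderiv.unique <| (hg z).congr_fun fun n => by
    rw [FormalMultilinearSeries.apply_eq_pow_smul_coeff, smul_apply,
      FormalMultilinearSeries.derivSeries_coeff_one, FormalMultilinearSeries.coeff_ofScalars]
    simp only [nsmul_eq_mul, Nat.cast_add, Nat.cast_one, smul_eq_mul]
    ring
  have hdiff : DifferentiableAt ℝ f z :=
    (hball.analyticAt_of_mem (by simp)).differentiableAt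
  rw [← hval, fderiv_apply_one_eq_deriv]
  exact hdiff.hasDerivAt

end PowerSeries

section WrightFunction

variable {ν : ℝ}

lemma hasSum_wrightKernel (μ ν z t : ℝ) {s : ℂ} (hs : s ≠ 0) :
    HasSum (fun j : ℕ => ((z ^ j / (j.factorial : ℝ) : ℝ) : ℂ) * wrightKernel (μ - ν * j) ν 0 t s)
      (wrightKernel μ ν z t s) := by
  have hexp := NormedSpace.expSeries_div_hasSum_exp ((z : ℂ) * s ^ (ν : ℂ))
  rw [← Complex.exp_eq_exp_ℂ] at hexp
  have hmul := hexp.mul_left (Complex.exp (s * t) * s ^ (-(μ : ℂ)))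
  rw [mul_assoc] at hmul
  refine hmul.congr_fun fun j => ?_
  have hpow : s ^ (-((μ - ν * j : ℝ) : ℂ)) = s ^ (-(μ : ℂ)) * (s ^ (ν : ℂ)) ^ j := by
    rw [← Complex.cpow_mul_nat, ← Complex.cpow_add _ _ hs]
    congr 1
    push_cast
    ring
  rw [wrightKernel, hpow]
  push_cast
  rw [zero_mul, Complex.exp_zero]
  ring

lemma hasSum_integral_wrightKernel_hankel (hν : ν < 1) (μ z : ℝ) {t : ℝ} (ht : 0 < t) :
    HasSum (fun j : ℕ => ∫ ρ : ℝ in Ioi 0, ((z ^ j / (j.factorial : ℝ) : ℝ) : ℂ) *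
        wrightKernel (μ - ν * j) ν 0 t (1 + ρ * (-1 + Complex.I)))
      (∫ ρ : ℝ in Ioi 0, wrightKernel μ ν z t (1 + ρ * (-1 + Complex.I))) := by
  obtain ⟨C, hC⟩ := exists_hankel_majorant_le hν μ |z| ht
  set r : ℝ → ℝ := fun ρ => ‖1 + ρ * (-1 + Complex.I)‖
  have hr : ∀ ρ ∈ Ioi (0 : ℝ), 0 < r ρ := fun ρ hρ =>
    one_half_pos.trans_le (one_half_le_norm_hankel_ray (le_of_lt hρ))
  have hmajorant : ∀ ρ, HasSum
      (fun j : ℕ => Real.exp ((1 - ρ) * t) *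
        (r ρ ^ (-μ) * ((|z| * r ρ ^ ν) ^ j / (j.factorial : ℝ))))
      (Real.exp ((1 - ρ) * t) * (r ρ ^ (-μ) * Real.exp (|z| * r ρ ^ ν))) := fun ρ => by
    have hexp := NormedSpace.expSeries_div_hasSum_exp (|z| * r ρ ^ ν)
    rw [← Real.exp_eq_exp_ℝ] at hexp
    exact (hexp.mul_left _).mul_left _
  refine hasSum_integral_of_dominated_convergence
    (fun j ρ => Real.exp ((1 - ρ) * t) *
      (r ρ ^ (-μ) * ((|z| * r ρ ^ ν) ^ j / (j.factorial : ℝ))))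
    (fun j => (integrableOn_wrightKernel_hankel_ray hν _ _ ht).aestronglyMeasurable.const_mul _)
    (fun j => ?_) (Eventually.of_forall fun ρ => (hmajorant ρ).summable) ?_ ?_
  · filter_upwards [ae_restrict_mem measurableSet_Ioi] with ρ hρ
    have hre : (1 + ρ * (-1 + Complex.I)).re = 1 - ρ := by simp [sub_eq_add_neg]
    rw [norm_mul, norm_wrightKernel, hre, Complex.norm_real, norm_div, norm_pow,
      Real.norm_eq_abs, Real.norm_natCast, zero_mul, Real.exp_zero, mul_one, neg_sub,
      sub_eq_add_neg (ν * j), Real.rpow_add (hr ρ hρ), mul_pow, Real.rpow_mul (hr ρ hρ).le,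
      Real.rpow_natCast]
    exact le_of_eq (by ring)
  · simp only [(hmajorant _).tsum_eq]
    refine integrable_of_norm_le_mul_inv_one_add_sq (C := C) ?_ measurableSet_Ioi fun ρ hρ => ?_
    · have hcont : Continuous r := by fun_prop
      have hpow : ∀ p : ℝ, ContinuousOn (fun ρ => r ρ ^ p) (Ioi 0) := fun p =>
        hcont.continuousOn.rpow_const fun ρ hρ => Or.inl (hr ρ hρ).ne'
      exact ((by fun_prop : Continuous fun ρ : ℝ => Real.exp ((1 - ρ) * t)).continuousOn.mul
        ((hpow _).mul (continuousOn_const.mul (hpow _)).rexp)).aestronglyMeasurable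
        measurableSet_Ioi
    · rw [Real.norm_of_nonneg (by positivity)]
      exact hC ρ (le_of_lt hρ)
  · filter_upwards [ae_restrict_mem measurableSet_Ioi] with ρ hρ
    exact hasSum_wrightKernel μ ν z t (norm_pos_iff.mp (hr ρ hρ))

lemma hasSum_hankelIntegral (hν : ν < 1) (μ z : ℝ) {t : ℝ} (ht : 0 < t) :
    HasSum (fun j : ℕ => z ^ j / (j.factorial : ℝ) * fracDelta (μ - ν * j) t)
      (hankelIntegral μ ν z t) := by
  have hsum := (hasSum_integral_wrightKernel_hankel hν μ z ht).mul_left (-1 + Complex.I)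
  have him := ((Complex.hasSum_iff _ _).mp hsum).2.mul_left (1 / π)
  rw [← integral_const_mul] at him
  refine him.congr_fun fun j => ?_
  rw [← hankelIntegral_zero hν _ ht, hankelIntegral, rayIntegral, integral_const_mul,
    integral_const_mul, mul_left_comm (-1 + Complex.I), Complex.im_ofReal_mul]
  ring

lemma hasSum_wrightW (hν : ν < 1) (μ z : ℝ) :
    HasSum (fun j : ℕ => ((j.factorial : ℝ) * Real.Gamma (-ν * j + μ))⁻¹ * z ^ j)
      (wrightW z (-ν) μ) := by
  have hterm : ∀ j : ℕ, ((j.factorial : ℝ) * Real.Gamma (-ν * j + μ))⁻¹ * z ^ j =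
      z ^ j / (j.factorial : ℝ) * fracDelta (μ - ν * j) 1 := fun j => by
    rw [fracDelta, Real.one_rpow, show μ - ν * j = -ν * j + μ by ring, mul_inv]
    ring
  have hsummable : Summable fun j : ℕ =>
      ((j.factorial : ℝ) * Real.Gamma (-ν * j + μ))⁻¹ * z ^ j := by
    simpa only [hterm] using (hasSum_hankelIntegral hν μ z one_pos).summable
  simpa only [wrightW, div_eq_mul_inv, mul_comm] using hsummable.hasSum

lemma hankelIntegral_eq_rpow_mul_wrightW (hν : ν < 1) (μ z : ℝ) {t : ℝ} (ht : 0 < t) :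
    hankelIntegral μ ν z t = t ^ (μ - 1) * wrightW (z * t ^ (-ν)) (-ν) μ := by
  refine (hasSum_hankelIntegral hν μ z ht).unique
    (((hasSum_wrightW hν μ (z * t ^ (-ν))).mul_left (t ^ (μ - 1))).congr_fun fun j => ?_)
  rw [fracDelta, show μ - ν * j - 1 = (μ - 1) + -ν * j by ring, Real.rpow_add ht,
    Real.rpow_mul ht.le, Real.rpow_natCast, mul_pow, show μ - ν * j = -ν * j + μ by ring, mul_inv]
  ring

lemma wrightW_zero (α β : ℝ) : wrightW 0 α β = (Real.Gamma β)⁻¹ := by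
  rw [wrightW, tsum_eq_single 0 fun j hj => by simp [hj]]
  simp

lemma auxR_eq_rpow_mul_wrightW (hν : 0 < ν) (hν' : ν ≤ 1 / 2) (μ : ℝ) {a t : ℝ}
    (ha : 0 ≤ a) (ht : 0 < t) :
    auxR μ ν a t = t ^ (μ - 1) * wrightW (-a * t ^ (-ν)) (-ν) μ := by
  rcases ha.eq_or_lt with rfl | ha
  · simp [auxR, fracDelta, wrightW_zero, div_eq_mul_inv]
  · rw [auxR_eq_hankelIntegral hν hν' μ ha ht.le,
      hankelIntegral_eq_rpow_mul_wrightW (by linarith) _ _ ht]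

lemma hasDerivAt_wrightW (hν : ν < 1) (μ z : ℝ) :
    HasDerivAt (fun z => wrightW z (-ν) μ) (wrightW z (-ν) (μ - ν)) z :=
  hasDerivAt_of_hasSum_pow (hasSum_wrightW hν μ)
    (fun z => (hasSum_wrightW hν (μ - ν) z).congr_fun fun j => by
      rw [Nat.factorial_succ, show -ν * (j + 1 : ℕ) + μ = -ν * j + (μ - ν) by push_cast; ring]
      push_cast
      field_simp) z

lemma analyticOnNhd_wrightW (hν : ν < 1) (μ : ℝ) :
    AnalyticOnNhd ℝ (fun z => wrightW z (-ν) μ) univ := fun _ _ =>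
  (hasFPowerSeriesOnBall_of_hasSum_pow (hasSum_wrightW hν μ)).analyticAt_of_mem (by simp)

lemma continuous_wrightW (hν : ν < 1) (μ : ℝ) : Continuous fun z => wrightW z (-ν) μ :=
  continuous_iff_continuousAt.mpr fun z => (hasDerivAt_wrightW hν μ z).continuousAt

lemma tendsto_wrightW_atTop (hν : 0 < ν) (hν' : ν ≤ 1 / 2) (μ : ℝ) :
    Tendsto (fun a => wrightW (-a) (-ν) μ) atTop (𝓝 0) := by
  refine (tendsto_auxR_atTop hν hν' μ 1).congr' ?_
  filter_upwards [eventually_ge_atTop 0] with a ha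
  simp [auxR_eq_rpow_mul_wrightW hν hν' μ ha one_pos]

end WrightFunction

section Time

variable {ν a β t : ℝ}

lemma hasDerivAt_wrightKernel_time (μ ν z t : ℝ) {s : ℂ} (hs : s ≠ 0) :
    HasDerivAt (fun t => wrightKernel μ ν z t s) (wrightKernel (μ - 1) ν z t s) t := by
  have hexp : HasDerivAt (fun t : ℝ => Complex.exp (s * t)) (Complex.exp (s * t) * s) t := by
    simpa using ((Complex.ofRealCLM.hasDerivAt (x := t)).const_mul s).cexp
  refine (hexp.mul_const _).congr_deriv ?_
  have hpow : s ^ (-((μ - 1 : ℝ) : ℂ)) = s ^ (-(μ : ℂ)) * s := by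
    nth_rewrite 3 [← Complex.cpow_one s]
    rw [← Complex.cpow_add _ _ hs]
    push_cast
    ring_nf
  rw [wrightKernel, hpow]
  ring

lemma hasDerivAt_auxR_time (hν : 0 < ν) (hν' : ν ≤ 1 / 2) (μ : ℝ) (ha : 0 < a) (t : ℝ) :
    HasDerivAt (auxR μ ν a) (auxR (μ - 1) ν a t) t := by
  obtain ⟨C, c, -, hC⟩ := exists_norm_wrightKernel_bromwich_le hν hν' (μ - 1) ha
  have hintegral := (hasDerivAt_integral_of_dominated_loc_of_deriv_le
    (F := fun t (y : ℝ) => wrightKernel μ ν (-a) t (1 + y * Complex.I))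
    (F' := fun t (y : ℝ) => wrightKernel (μ - 1) ν (-a) t (1 + y * Complex.I))
    (bound := fun y => |C| * Real.exp (-(c * a)) * Real.exp (t + 1) * (1 + y ^ 2)⁻¹)
    (Metric.ball_mem_nhds t one_pos)
    (Eventually.of_forall fun t =>
      (continuous_wrightKernel_bromwich μ ν (-a) t).aestronglyMeasurable)
    (integrable_wrightKernel_bromwich hν hν' μ ha t)
    (continuous_wrightKernel_bromwich _ _ _ _).aestronglyMeasurable
    (Eventually.of_forall fun y s hs => (hC a s y le_rfl).trans ?_)
    (integrable_inv_one_add_sq.const_mul _)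
    (Eventually.of_forall fun y s _ => hasDerivAt_wrightKernel_time μ ν (-a) s
      (Complex.slitPlane_ne_zero (one_add_mul_I_mem_slitPlane y)))).2
  · rw [funext (auxR_eq_integral_bromwich μ ν ha), auxR_eq_integral_bromwich (μ - 1) ν ha]
    exact (Complex.reCLM.hasFDerivAt.comp_hasDerivAt t hintegral).const_mul (1 / (2 * π))
  · have hst : s ≤ t + 1 := by
      rw [Metric.mem_ball, Real.dist_eq] at hs
      linarith [(abs_lt.mp hs).2]
    gcongr
    exact le_abs_self C

lemma continuous_auxR_time (hν : 0 < ν) (hν' : ν ≤ 1 / 2) (μ : ℝ) (ha : 0 < a) :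
    Continuous (auxR μ ν a) :=
  continuous_iff_continuousAt.mpr fun t => (hasDerivAt_auxR_time hν hν' μ ha t).continuousAt

lemma deriv_auxR_time (hν : 0 < ν) (hν' : ν ≤ 1 / 2) (μ : ℝ) (ha : 0 < a) :
    deriv (auxR μ ν a) = auxR (μ - 1) ν a :=
  funext fun t => (hasDerivAt_auxR_time hν hν' μ ha t).deriv

lemma contDiff_one_auxR_time (hν : 0 < ν) (hν' : ν ≤ 1 / 2) (μ : ℝ) (ha : 0 < a) :
    ContDiff ℝ 1 (auxR μ ν a) := by
  refine contDiff_one_iff_deriv.mpr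
    ⟨fun t => (hasDerivAt_auxR_time hν hν' μ ha t).differentiableAt, ?_⟩
  rw [deriv_auxR_time hν hν' μ ha]
  exact continuous_auxR_time hν hν' _ ha

lemma tendsto_auxR_time_zero (hν : 0 < ν) (hν' : ν ≤ 1 / 2) (μ : ℝ) (ha : 0 < a) :
    Tendsto (auxR μ ν a) (𝓝[>] 0) (𝓝 0) := by
  have hlim := (continuous_auxR_time hν hν' μ ha).tendsto 0
  rw [auxR_of_nonpos hν hν' μ ha le_rfl] at hlim
  exact hlim.mono_left nhdsWithin_le_nhds

lemma intervalIntegrable_sub_rpow (hβ : 0 < β) (s t : ℝ) :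
    IntervalIntegrable (fun τ : ℝ => (t - τ) ^ (β - 1)) volume s t := by
  simpa using ((intervalIntegral.intervalIntegrable_rpow' (a := 0) (b := t - s)
    (by linarith : -1 < β - 1)).comp_sub_left t).symm

open ProbabilityTheory in
/-- On the line `Re s = 1` the factor `e ^ (-s σ)` which shifts the time by `σ` becomes, weighted
with `e ^ σ`, a character, so that integration over `σ` gives the characteristic function
`(1 + i y) ^ (-β)` of the Gamma distribution. -/
lemma integral_exp_mul_auxR_sub_gammaMeasure (hν : 0 < ν) (hν' : ν ≤ 1 / 2) (μ : ℝ) (ha : 0 < a)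
    (hβ : 0 < β) (t : ℝ) :
    ∫ σ, Real.exp σ * auxR μ ν a (t - σ) ∂gammaMeasure β 1 = auxR (μ + β) ν a t := by
  have : IsProbabilityMeasure (gammaMeasure β 1) := isProbabilityMeasure_gammaMeasure hβ one_pos
  have hshift : ∀ σ y : ℝ, (Real.exp σ : ℂ) * wrightKernel μ ν (-a) (t - σ) (1 + y * Complex.I) =
      Complex.exp (-(y * Complex.I) * σ) * wrightKernel μ ν (-a) t (1 + y * Complex.I) :=
    fun σ y => by
      simp only [wrightKernel, ← mul_assoc, Complex.ofReal_exp, ← Complex.exp_add]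
      push_cast
      ring_nf
  have hint : Integrable (Function.uncurry fun σ y : ℝ =>
      Complex.exp (-(y * Complex.I) * σ) * wrightKernel μ ν (-a) t (1 + y * Complex.I))
      ((gammaMeasure β 1).prod volume) := by
    refine ((integrable_wrightKernel_bromwich hν hν' μ ha t).comp_snd _).bdd_mul (c := 1)
      (by fun_prop) (Eventually.of_forall fun p => ?_)
    rw [Complex.norm_exp]
    simp
  have hgamma : ∀ y : ℝ, ∫ σ : ℝ, Complex.exp (-(y * Complex.I) * σ) *
      wrightKernel μ ν (-a) t (1 + y * Complex.I) ∂gammaMeasure β 1 =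
        wrightKernel (μ + β) ν (-a) t (1 + y * Complex.I) := fun y => by
    have hmgf := complexMGF_gammaMeasure hβ one_pos (z := -(y * Complex.I)) (by simp)
    rw [Complex.ofReal_one, div_one, sub_neg_eq_add] at hmgf
    rw [integral_mul_const, show ∫ σ : ℝ, Complex.exp (-(y * Complex.I) * σ) ∂gammaMeasure β 1 =
      (1 + y * Complex.I) ^ (-β : ℂ) from hmgf, wrightKernel, wrightKernel, mul_left_comm,
      ← mul_assoc (_ ^ _), ← Complex.cpow_add _ _
        (Complex.slitPlane_ne_zero (one_add_mul_I_mem_slitPlane y))]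
    push_cast
    ring_nf
  have hswap := integral_integral_swap hint
  have hintσ := hint.integral_prod_left
  simp only [Function.uncurry_apply_pair, ← hshift, integral_const_mul] at hintσ
  simp only [hgamma] at hswap
  simp only [← hshift, integral_const_mul] at hswap
  rw [auxR_eq_integral_bromwich _ ν ha, ← hswap, ← RCLike.re_eq_complex_re, ← integral_re hintσ,
    ← integral_const_mul]
  simp only [RCLike.re_eq_complex_re, Complex.re_ofReal_mul, auxR_eq_integral_bromwich _ ν ha,
    mul_left_comm]

open ProbabilityTheory in
lemma integral_Ioi_rpow_mul_auxR_sub (hν : 0 < ν) (hν' : ν ≤ 1 / 2) (μ : ℝ) (ha : 0 < a)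
    (hβ : 0 < β) (t : ℝ) :
    ∫ σ in Ioi 0, σ ^ (β - 1) * auxR μ ν a (t - σ) = Real.Gamma β * auxR (μ + β) ν a t := by
  rw [← integral_exp_mul_auxR_sub_gammaMeasure hν hν' μ ha hβ t, integral_gammaMeasure hβ one_pos,
    ← integral_const_mul, ← integral_Ici_eq_integral_Ioi, ← integral_indicator measurableSet_Ici]
  congr 1
  ext σ
  rw [gammaPDFReal, indicator_apply]
  split_ifs with hσ hσ' hσ'
  · rw [one_mul, Real.one_rpow, Real.exp_neg, smul_eq_mul]
    have := Real.exp_ne_zero σ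
    have := (Real.Gamma_pos_of_pos hβ).ne'
    field_simp
  · exact absurd hσ hσ'
  · exact absurd hσ' hσ
  · simp

lemma integral_sub_rpow_mul_auxR (hν : 0 < ν) (hν' : ν ≤ 1 / 2) (μ : ℝ) (ha : 0 < a)
    (hβ : 0 < β) (ht : 0 ≤ t) :
    ∫ τ in 0..t, (t - τ) ^ (β - 1) * auxR μ ν a τ = Real.Gamma β * auxR (μ + β) ν a t := by
  have hsub := intervalIntegral.integral_comp_sub_left
    (fun σ => σ ^ (β - 1) * auxR μ ν a (t - σ)) (a := 0) (b := t) t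
  simp only [sub_sub_cancel, sub_self, sub_zero] at hsub
  rw [hsub, intervalIntegral.integral_of_le ht, ← integral_Ioi_rpow_mul_auxR_sub hν hν' μ ha hβ]
  refine (setIntegral_eq_of_subset_of_forall_sdiff_eq_zero measurableSet_Ioi Ioc_subset_Ioi_self
    fun σ hσ => ?_).symm
  have hσt : t < σ := not_le.mp fun hle => hσ.2 ⟨hσ.1, hle⟩
  rw [auxR_of_nonpos hν hν' μ ha (sub_nonpos.mpr hσt.le), mul_zero]

lemma rlIntegrable_const_mul_auxR (hν : 0 < ν) (hν' : ν ≤ 1 / 2) (μ : ℝ) (ha : 0 < a)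
    (hβ : 0 ≤ β) (t c : ℝ) : RLIntegrable β (fun τ => c * auxR μ ν a τ) t := by
  rcases hβ.eq_or_lt with rfl | hβ
  · exact Or.inl rfl
  · exact Or.inr ((intervalIntegrable_sub_rpow hβ 0 t).mul_continuousOn
      ((continuous_auxR_time hν hν' μ ha).const_mul c).continuousOn)

lemma rlIntegral_const_mul_auxR (hν : 0 < ν) (hν' : ν ≤ 1 / 2) (μ : ℝ) (ha : 0 < a)
    (hβ : 0 ≤ β) (ht : 0 ≤ t) (c : ℝ) :
    rlIntegral β (fun τ => c * auxR μ ν a τ) t = c * auxR (μ + β) ν a t := by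
  rcases hβ.eq_or_lt with rfl | hβ
  · simp [rlIntegral]
  · simp only [rlIntegral, if_neg hβ.ne', mul_left_comm _ c]
    rw [intervalIntegral.integral_const_mul, integral_sub_rpow_mul_auxR hν hν' μ ha hβ ht]
    have := (Real.Gamma_pos_of_pos hβ).ne'
    field_simp

lemma natCeil_two_mul (hν : 0 < ν) (hν' : ν ≤ 1 / 2) : ⌈2 * ν⌉₊ = 1 := by
  rw [Nat.ceil_eq_iff one_ne_zero]
  constructor
  · simpa using hν
  · push_cast; linarith

lemma hasCaputoDeriv_two_mul_iff (hν : 0 < ν) (hν' : ν ≤ 1 / 2) (y : ℝ → ℝ) (t d : ℝ) :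
    HasCaputoDeriv (2 * ν) y t d ↔ ContDiffOn ℝ 1 y (Ioi 0) ∧
      RLIntegrable (1 - 2 * ν) (deriv y) t ∧ rlIntegral (1 - 2 * ν) (deriv y) t = d := by
  rw [HasCaputoDeriv, natCeil_two_mul hν hν', iteratedDeriv_one, Nat.cast_one, Nat.cast_one]

end Time

section Beta

variable {a b t : ℝ}

lemma integral_sub_rpow_mul_rpow (ha : 0 < a) (hb : 0 < b) (ht : 0 < t) :
    ∫ τ in 0..t, (t - τ) ^ (a - 1) * τ ^ (b - 1) =
      Real.Gamma a * Real.Gamma b / Real.Gamma (a + b) * t ^ (a + b - 1) := by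
  have hscaled := Complex.betaIntegral_scaled (b : ℂ) (a : ℂ) ht
  have hreal : ∫ x in 0..t, (x : ℂ) ^ ((b : ℂ) - 1) * ((t : ℂ) - x) ^ ((a : ℂ) - 1) =
      (∫ τ in 0..t, (t - τ) ^ (a - 1) * τ ^ (b - 1) : ℝ) := by
    rw [← intervalIntegral.integral_ofReal]
    refine intervalIntegral.integral_congr fun x hx => ?_
    rw [uIcc_of_le ht.le] at hx
    rw [Complex.ofReal_mul, Complex.ofReal_cpow hx.1, Complex.ofReal_cpow (sub_nonneg.mpr hx.2)]
    push_cast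
    ring
  rw [hreal, Complex.betaIntegral_eq_Gamma_mul_div _ _ (by simpa using hb) (by simpa using ha),
    add_comm (b : ℂ)] at hscaled
  simp only [← Complex.ofReal_add, Complex.Gamma_ofReal, ← Complex.ofReal_one,
    ← Complex.ofReal_sub, ← Complex.ofReal_cpow ht.le, ← Complex.ofReal_mul,
    ← Complex.ofReal_div] at hscaled
  rw [Complex.ofReal_inj.mp hscaled]
  ring

lemma intervalIntegrable_sub_rpow_mul_rpow (ha : 0 < a) (hb : 0 < b) (ht : 0 < t) :
    IntervalIntegrable (fun τ : ℝ => (t - τ) ^ (a - 1) * τ ^ (b - 1)) volume 0 t := by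
  refine intervalIntegral.intervalIntegrable_of_integral_ne_zero ?_
  rw [integral_sub_rpow_mul_rpow ha hb ht]
  have := Real.Gamma_pos_of_pos ha
  have := Real.Gamma_pos_of_pos hb
  have := Real.Gamma_pos_of_pos (add_pos ha hb)
  positivity

end Beta

section Extremum

lemma exists_pos_isMaxOn_Ici {f : ℝ → ℝ} {z l : ℝ} (hf : ContinuousOn f (Ici 0))
    (hlim : Tendsto f atTop (𝓝 l)) (hz : 0 < z) (hzero : f 0 ≤ f z) (hl : l ≤ f z) :
    ∃ z₀, 0 < z₀ ∧ IsMaxOn f (Ici 0) z₀ := by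
  by_cases hlarger : ∃ x ∈ Ici (0 : ℝ), f z < f x
  · obtain ⟨x, hx, hzx⟩ := hlarger
    have hev : ∀ᶠ y in cocompact ℝ ⊓ 𝓟 (Ici 0), f y ≤ f x := by
      rw [cocompact_eq_atBot_atTop, inf_sup_right, eventually_sup]
      refine ⟨?_, (hlim.eventually_le_const (hl.trans_lt hzx)).filter_mono inf_le_left⟩
      rw [eventually_inf_principal]
      filter_upwards [eventually_lt_atBot 0] with y hy hy'
      exact absurd hy' hy.not_ge
    obtain ⟨z₀, hz₀, hmax⟩ := hf.exists_isMaxOn' isClosed_Ici hx hev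
    refine ⟨z₀, lt_of_le_of_ne hz₀ ?_, hmax⟩
    rintro rfl
    exact (hzero.trans_lt hzx).not_ge (hmax hx)
  · push Not at hlarger
    exact ⟨z, hz, hlarger⟩

lemma nonpos_of_isLocalMax_of_hasDerivAt {f f' : ℝ → ℝ} {x d : ℝ} (hmax : IsLocalMax f x)
    (hf : ∀ᶠ y in 𝓝 x, HasDerivAt f (f' y) y) (hf' : HasDerivAt f' d x) : d ≤ 0 := by
  by_contra! hd
  have hderiv : deriv f =ᶠ[𝓝 x] f' := hf.mono fun y hy => hy.deriv
  have hmin : IsLocalMin f x := isLocalMin_of_deriv_deriv_pos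
    (by rwa [hderiv.deriv_eq, hf'.deriv]) hmax.deriv_eq_zero hf.self_of_nhds.continuousAt
  have hconst : f =ᶠ[𝓝 x] fun _ => f x := by
    filter_upwards [hmax, hmin] with y hle hge using le_antisymm hle hge
  have hzero : f' =ᶠ[𝓝 x] fun _ => 0 := hderiv.symm.trans (by simpa using hconst.deriv)
  exact hd.ne (hf'.unique (hzero.hasDerivAt_iff.mpr (hasDerivAt_const x 0))).symm

variable {g : ℝ → ℝ} {β s t : ℝ}

lemma sub_rpow_mul_eq_dslope (g : ℝ → ℝ) (β : ℝ) {τ : ℝ} (hτ : τ < t) :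
    (t - τ) ^ (β - 1) * (g t - g τ) = (t - τ) ^ β * dslope g t τ := by
  have hslope := sub_smul_dslope g t τ
  rw [smul_eq_mul] at hslope
  rw [Real.rpow_sub_one (sub_pos.mpr hτ).ne']
  have := (sub_pos.mpr hτ).ne'
  field_simp
  linear_combination (t - τ) ^ β * hslope

lemma hasDerivAt_neg_sub_rpow_mul_sub (hg : Differentiable ℝ g) (β : ℝ) {τ : ℝ} (hτ : τ < t) :
    HasDerivAt (fun τ => -((t - τ) ^ (β - 1) * (g t - g τ)))
      ((t - τ) ^ (β - 1) * deriv g τ - (1 - β) * (t - τ) ^ (β - 1 - 1) * (g t - g τ)) τ := by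
  have hpow := ((hasDerivAt_id τ).const_sub t).rpow_const (p := β - 1)
    (Or.inl (sub_pos.mpr hτ).ne')
  refine (hpow.mul ((hg τ).hasDerivAt.const_sub (g t))).neg.congr_deriv ?_
  simp only [id]
  ring

lemma intervalIntegrable_sub_rpow_mul_deriv (hg : ContDiff ℝ 1 g) (hβ : 0 < β) :
    IntervalIntegrable (fun τ => (t - τ) ^ (β - 1) * deriv g τ) volume s t :=
  (intervalIntegrable_sub_rpow hβ s t).mul_continuousOn
    (hg.continuous_deriv le_rfl).continuousOn

/-- Luchko's extremum principle: integrate by parts, with `g t - g τ` as primitive of `-g'`. -/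
lemma sub_rpow_mul_sub_le_integral (hg : ContDiff ℝ 1 g) (hβ : 0 < β) (hβ' : β ≤ 1) (hst : s < t)
    (hmax : ∀ τ ∈ Ioo s t, g τ ≤ g t) :
    (t - s) ^ (β - 1) * (g t - g s) ≤ ∫ τ in s..t, (t - τ) ^ (β - 1) * deriv g τ := by
  have hdslope : Continuous (dslope g t) := continuousOn_univ.mp
    ((continuousOn_dslope univ_mem).mpr
      ⟨hg.continuous.continuousOn, (hg.differentiable one_ne_zero) t⟩)
  have hle := intervalIntegral.sub_le_integral_of_hasDeriv_right_of_le hst.le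
    (g := fun τ => -((t - τ) ^ β * dslope g t τ))
    (((continuous_const.sub continuous_id).rpow_const fun _ => Or.inr hβ.le).mul
      hdslope).neg.continuousOn
    (fun τ hτ => ((hasDerivAt_neg_sub_rpow_mul_sub (hg.differentiable one_ne_zero) β
      hτ.2).congr_of_eventuallyEq ?_).hasDerivWithinAt)
    ((intervalIntegrable_iff_integrableOn_Icc_of_le hst.le).mp
      (intervalIntegrable_sub_rpow_mul_deriv hg hβ)) fun τ hτ => ?_
  · simpa [Real.zero_rpow hβ.ne', sub_rpow_mul_eq_dslope g β hst] using hle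
  · filter_upwards [Iio_mem_nhds hτ.2] with σ hσ
    rw [sub_rpow_mul_eq_dslope g β hσ]
  · have := Real.rpow_nonneg (sub_pos.mpr hτ.2).le (β - 1 - 1)
    exact sub_le_self _ (mul_nonneg (mul_nonneg (sub_nonneg.mpr hβ') this)
      (sub_nonneg.mpr (hmax τ hτ)))

lemma sub_rpow_mul_sub_lt_integral (hg : ContDiff ℝ 1 g) (hβ : 0 < β) (hβ' : β < 1)
    (hmax : ∀ τ ∈ Ioo s t, g τ ≤ g t) (hlt : ∃ τ ∈ Ioo s t, g τ < g t) :
    (t - s) ^ (β - 1) * (g t - g s) < ∫ τ in s..t, (t - τ) ^ (β - 1) * deriv g τ := by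
  obtain ⟨σ, hσ, hσlt⟩ := hlt
  have hbefore : ∀ τ ∈ Icc s σ, τ < t := fun τ hτ => hτ.2.trans_lt hσ.2
  have hdiff := hg.differentiable one_ne_zero
  have hpow : ∀ p : ℝ, ContinuousOn (fun τ => (t - τ) ^ p) (Icc s σ) := fun p =>
    (continuousOn_const.sub continuousOn_id).rpow_const
      fun τ hτ => Or.inl (sub_pos.mpr (hbefore τ hτ)).ne'
  have hweight : ContinuousOn (fun τ => (t - τ) ^ (β - 1) * deriv g τ) (Icc s σ) :=
    (hpow _).mul (hg.continuous_deriv le_rfl).continuousOn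
  have hF' : ContinuousOn (fun τ => (t - τ) ^ (β - 1) * deriv g τ
      - (1 - β) * (t - τ) ^ (β - 1 - 1) * (g t - g τ)) (Icc s σ) :=
    hweight.sub ((continuousOn_const.mul (hpow _)).mul
      (continuousOn_const.sub hg.continuous.continuousOn))
  have hgain : ∀ τ < t, 0 < (1 - β) * (t - τ) ^ (β - 1 - 1) := fun τ hτ =>
    mul_pos (sub_pos.mpr hβ') (Real.rpow_pos_of_pos (sub_pos.mpr hτ) _)
  have hleft : (t - s) ^ (β - 1) * (g t - g s) - (t - σ) ^ (β - 1) * (g t - g σ) <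
      ∫ τ in s..σ, (t - τ) ^ (β - 1) * deriv g τ := by
    rw [← neg_sub_neg, ← intervalIntegral.integral_eq_sub_of_hasDerivAt
      (fun τ hτ => hasDerivAt_neg_sub_rpow_mul_sub hdiff β
        (hbefore τ (by rwa [uIcc_of_le hσ.1.le] at hτ)))
      (hF'.intervalIntegrable_of_Icc hσ.1.le)]
    refine intervalIntegral.integral_lt_integral_of_continuousOn_of_le_of_exists_lt hσ.1 hF'
      hweight (fun τ hτ => ?_) ⟨σ, right_mem_Icc.mpr hσ.1.le, ?_⟩
    · exact sub_le_self _ (mul_nonneg (hgain τ (hτ.2.trans_lt hσ.2)).le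
        (sub_nonneg.mpr (hmax τ ⟨hτ.1, hτ.2.trans_lt hσ.2⟩)))
    · exact sub_lt_self _ (mul_pos (hgain σ hσ.2) (sub_pos.mpr hσlt))
  have hright := sub_rpow_mul_sub_le_integral hg hβ hβ'.le hσ.2
    fun τ hτ => hmax τ ⟨hσ.1.trans hτ.1, hτ.2⟩
  rw [← intervalIntegral.integral_add_adjacent_intervals
    (hweight.intervalIntegrable_of_Icc hσ.1.le) (intervalIntegrable_sub_rpow_mul_deriv hg hβ)]
  linarith

end Extremum

section Positivity

variable {ν : ℝ}

lemma hasDerivAt_wrightW_neg (hν : ν < 1) (μ z : ℝ) :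
    HasDerivAt (fun z => wrightW (-z) (-ν) μ) (-wrightW (-z) (-ν) (μ - ν)) z := by
  simpa [Function.comp_def] using (hasDerivAt_wrightW hν μ (-z)).comp z (hasDerivAt_neg z)

lemma tendsto_wrightW_neg_two_mul_atTop (hν : 0 < ν) (hν' : ν ≤ 1 / 2) (μ : ℝ) :
    Tendsto (fun α => wrightW (-2 * α) (-ν) μ) atTop (𝓝 0) := by
  simpa [Function.comp_def] using (tendsto_wrightW_atTop hν hν' μ).comp
    (tendsto_id.const_mul_atTop (two_pos : (0 : ℝ) < 2))

lemma exists_wrightW_neg_ne (hν : 0 < ν) (hν' : ν ≤ 1 / 2) (z l : ℝ) :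
    ∃ y, z < y ∧ wrightW (-y) (-ν) 1 ≠ l := by
  by_contra! hconst
  have heq : (fun z => wrightW z (-ν) 1) = fun _ => l := by
    refine (analyticOnNhd_wrightW (by linarith) 1).eq_of_eventuallyEq analyticOnNhd_const
      (z₀ := -z - 1) ?_
    filter_upwards [Iio_mem_nhds (sub_one_lt (-z))] with y hy
    simpa using hconst (-y) (lt_neg_of_lt_neg hy)
  have hl : 0 = l := tendsto_nhds_unique (tendsto_wrightW_atTop hν hν' 1)
    (tendsto_const_nhds.congr fun a => (congrFun heq (-a)).symm)
  have hone := congrFun heq 0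
  simp only [wrightW_zero, Real.Gamma_one, inv_one] at hone
  exact one_ne_zero (hone.trans hl.symm)

lemma auxR_one_eq_wrightW (hν : 0 < ν) (hν' : ν ≤ 1 / 2) {z τ : ℝ} (hz : 0 ≤ z) (hτ : 0 < τ) :
    auxR 1 ν z τ = wrightW (-(z * τ ^ (-ν))) (-ν) 1 := by
  simp [auxR_eq_rpow_mul_wrightW hν hν' 1 hz hτ]

lemma exists_mem_Ioo_auxR_one_ne (hν : 0 < ν) (hν' : ν ≤ 1 / 2) {z : ℝ} (hz : 0 < z) :
    ∃ τ ∈ Ioo (0 : ℝ) 1, auxR 1 ν z τ ≠ auxR 1 ν z 1 := by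
  obtain ⟨y, hzy, hy⟩ := exists_wrightW_neg_ne hν hν' z (wrightW (-z) (-ν) 1)
  have hratio : 0 < z / y := div_pos hz (hz.trans hzy)
  have hτ : (z / y) ^ ν⁻¹ ∈ Ioo (0 : ℝ) 1 := ⟨by positivity,
    Real.rpow_lt_one hratio.le ((div_lt_one (hz.trans hzy)).mpr hzy) (inv_pos.mpr hν)⟩
  refine ⟨_, hτ, ?_⟩
  have harg : z * ((z / y) ^ ν⁻¹) ^ (-ν) = y := by
    rw [← Real.rpow_mul hratio.le, mul_neg, inv_mul_cancel₀ hν.ne', Real.rpow_neg_one]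
    field_simp
  rwa [auxR_one_eq_wrightW hν hν' hz.le hτ.1, auxR_one_eq_wrightW hν hν' hz.le one_pos, harg,
    Real.one_rpow, mul_one]

/-- A spatial maximum of the similarity profile is a maximum of `auxR 1 ν z` over times up to `1`,
so the extremum principle makes its fractional time derivative positive. -/
lemma mul_wrightW_neg_pos_of_isMaxOn (hν : 0 < ν) (hν' : ν < 1 / 2) {c z : ℝ} (hc : c ≠ 0)
    (hz : 0 < z) (hmax : IsMaxOn (fun z => c * wrightW (-z) (-ν) 1) (Ici 0) z) :
    0 < c * wrightW (-z) (-ν) (1 - 2 * ν) := by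
  have hone : auxR 1 ν z 1 = wrightW (-z) (-ν) 1 := by
    simp [auxR_one_eq_wrightW hν hν'.le hz.le one_pos]
  have hmaxtime : ∀ τ ∈ Ioo (0 : ℝ) 1, c * auxR 1 ν z τ ≤ c * auxR 1 ν z 1 := fun τ hτ => by
    have hτ₀ := hτ.1
    rw [auxR_one_eq_wrightW hν hν'.le hz.le hτ₀, hone]
    exact hmax (mem_Ici.mpr (by positivity))
  obtain ⟨σ, hσ, hne⟩ := exists_mem_Ioo_auxR_one_ne hν hν'.le hz
  have hnonneg : 0 ≤ c * wrightW (-z) (-ν) 1 := by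
    have hlim := (tendsto_wrightW_atTop hν hν'.le 1).const_mul c
    rw [mul_zero] at hlim
    exact le_of_tendsto hlim ((eventually_ge_atTop 0).mono fun y hy => hmax hy)
  have hβ : 0 < 1 - 2 * ν := by linarith
  have hextremum := sub_rpow_mul_sub_lt_integral
    (contDiff_const.mul (contDiff_one_auxR_time hν hν'.le 1 hz)) hβ (by linarith) hmaxtime
    ⟨σ, hσ, (hmaxtime σ hσ).lt_of_ne fun heq => hne (mul_left_cancel₀ hc heq)⟩
  simp only [deriv_const_mul_field', deriv_auxR_time hν hν'.le 1 hz, mul_left_comm _ c]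
    at hextremum
  rw [intervalIntegral.integral_const_mul, sub_self 1,
    integral_sub_rpow_mul_auxR hν hν'.le 0 hz hβ zero_le_one, hone,
    auxR_of_nonpos hν hν'.le 1 hz le_rfl,
    auxR_eq_rpow_mul_wrightW hν hν'.le _ hz.le one_pos] at hextremum
  simp only [sub_zero, Real.one_rpow, one_mul, mul_one, zero_add, mul_zero,
    mul_left_comm c] at hextremum
  exact pos_of_mul_pos_right (hnonneg.trans_lt hextremum) (Real.Gamma_pos_of_pos hβ).le

lemma not_isMaxOn_mul_wrightW_neg (hν : 0 < ν) (hν' : ν < 1 / 2) {c z : ℝ} (hc : c ≠ 0)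
    (hz : 0 < z) : ¬ IsMaxOn (fun z => c * wrightW (-z) (-ν) 1) (Ici 0) z := fun hmax => by
  have hν₁ : ν < 1 := by linarith
  refine (mul_wrightW_neg_pos_of_isMaxOn hν hν' hc hz hmax).not_ge
    (nonpos_of_isLocalMax_of_hasDerivAt (hmax.isLocalMax (Ici_mem_nhds hz))
      (Eventually.of_forall fun y => (hasDerivAt_wrightW_neg hν₁ 1 y).const_mul c) ?_)
  refine ((hasDerivAt_wrightW_neg hν₁ (1 - ν) z).neg.const_mul c).congr_deriv ?_
  rw [neg_neg, sub_sub, two_mul]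

lemma mul_wrightW_neg_lt_max (hν : 0 < ν) (hν' : ν < 1 / 2) {c z : ℝ} (hc : c ≠ 0) (hz : 0 < z) :
    c * wrightW (-z) (-ν) 1 < max c 0 := by
  by_contra! hle
  have hcont : Continuous fun z => c * wrightW (-z) (-ν) 1 :=
    continuous_const.mul ((continuous_wrightW (by linarith) 1).comp continuous_neg)
  have hlim := (tendsto_wrightW_atTop hν hν'.le 1).const_mul c
  rw [mul_zero] at hlim
  obtain ⟨z₀, hz₀, hmax⟩ := exists_pos_isMaxOn_Ici hcont.continuousOn hlim hz
    (by simpa [wrightW_zero] using (le_max_left c 0).trans hle) ((le_max_right c 0).trans hle)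
  exact not_isMaxOn_mul_wrightW_neg hν hν' hc hz₀ hmax

lemma wrightW_neg_mem_Ioo_of_lt_half (hν : 0 < ν) (hν' : ν < 1 / 2) {x : ℝ} (hx : 0 < x) :
    wrightW (-x) (-ν) 1 ∈ Ioo (0 : ℝ) 1 := by
  constructor
  · simpa using mul_wrightW_neg_lt_max hν hν' (neg_ne_zero.mpr one_ne_zero) hx
  · simpa using mul_wrightW_neg_lt_max hν hν' one_ne_zero hx

end Positivity

section ErrorFunction

lemma hasDerivAt_wrightW_neg_half_half (z : ℝ) :
    HasDerivAt (fun z => wrightW z (-(1 / 2)) (1 / 2))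
      (-(z / 2) * wrightW z (-(1 / 2)) (1 / 2)) z := by
  have hrecurrence := hankelIntegral_recurrence (by norm_num : (1 / 2 : ℝ) < 1) 0 z one_pos
  simp only [hankelIntegral_eq_rpow_mul_wrightW (by norm_num : (1 / 2 : ℝ) < 1) _ _ one_pos,
    Real.one_rpow, one_mul, mul_one, zero_mul, zero_add, sub_zero,
    show (1 : ℝ) - 1 / 2 = 1 / 2 by norm_num] at hrecurrence
  refine (hasDerivAt_wrightW (by norm_num : (1 / 2 : ℝ) < 1) (1 / 2) z).congr_deriv ?_
  rw [sub_self]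
  linear_combination hrecurrence

lemma wrightW_neg_half_half (z : ℝ) :
    wrightW z (-(1 / 2)) (1 / 2) = Real.exp (-(z ^ 2 / 4)) / √π := by
  have hproduct : ∀ z : ℝ, HasDerivAt
      (fun z => wrightW z (-(1 / 2)) (1 / 2) * Real.exp (z ^ 2 / 4)) 0 z := fun z => by
    refine ((hasDerivAt_wrightW_neg_half_half z).mul
      (((hasDerivAt_pow 2 z).div_const 4).exp)).congr_deriv ?_
    push_cast
    ring
  have hconst := is_const_of_deriv_eq_zero (fun z => (hproduct z).differentiableAt)
    (fun z => (hproduct z).deriv) z 0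
  simp only [wrightW_zero, Real.Gamma_one_half_eq, ne_eq, OfNat.ofNat_ne_zero, not_false_eq_true,
    zero_pow, zero_div, Real.exp_zero, mul_one] at hconst
  rw [Real.exp_neg, inv_div_left, mul_comm, mul_inv, ← hconst]
  have := (Real.exp_pos (z ^ 2 / 4)).ne'
  field_simp

lemma hasDerivAt_errorFun (x : ℝ) :
    HasDerivAt errorFun (2 / √π * Real.exp (-x ^ 2)) x :=
  ((by fun_prop : Continuous fun s : ℝ => Real.exp (-s ^ 2)).integral_hasStrictDerivAt 0
    x).hasDerivAt.const_mul _

lemma errorFun_zero : errorFun 0 = 0 := by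
  rw [errorFun, intervalIntegral.integral_same, mul_zero]

lemma strictMono_errorFun : StrictMono errorFun :=
  strictMono_of_deriv_pos fun x => by
    rw [(hasDerivAt_errorFun x).deriv]
    positivity

lemma wrightW_neg_half_one (x : ℝ) : wrightW (-2 * x) (-(1 / 2)) 1 = 1 - errorFun x := by
  have hsum : ∀ x, HasDerivAt (fun x => wrightW (-2 * x) (-(1 / 2)) 1 + errorFun x) 0 x :=
    fun x => by
      have hW := (hasDerivAt_wrightW (by norm_num : (1 / 2 : ℝ) < 1) 1 (-2 * x)).comp x
        ((hasDerivAt_id x).const_mul (-2))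
      refine (hW.add (hasDerivAt_errorFun x)).congr_deriv ?_
      rw [show (1 : ℝ) - 1 / 2 = 1 / 2 by norm_num, wrightW_neg_half_half]
      ring_nf
  have hconst := is_const_of_deriv_eq_zero (fun x => (hsum x).differentiableAt)
    (fun x => (hsum x).deriv) x 0
  rw [mul_zero, wrightW_zero, Real.Gamma_one, errorFun_zero, inv_one, add_zero] at hconst
  exact eq_sub_of_add_eq hconst

lemma errorFun_lt_one (x : ℝ) : errorFun x < 1 := by
  have hone := (tendsto_const_nhds (x := (1 : ℝ))).sub
    (tendsto_wrightW_neg_two_mul_atTop one_half_pos le_rfl 1)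
  simp only [wrightW_neg_half_one, sub_sub_cancel, sub_zero] at hone
  exact (strictMono_errorFun (lt_add_one x)).trans_le
    (strictMono_errorFun.monotone.ge_of_tendsto hone _)

lemma wrightW_neg_mem_Ioo {ν x : ℝ} (hν : 0 < ν) (hν' : ν ≤ 1 / 2) (hx : 0 < x) :
    wrightW (-x) (-ν) 1 ∈ Ioo (0 : ℝ) 1 := by
  rcases hν'.eq_or_lt with rfl | hν'
  · have hpos := strictMono_errorFun (half_pos hx)
    rw [errorFun_zero] at hpos
    rw [show -x = -2 * (x / 2) by ring, wrightW_neg_half_one]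
    exact ⟨sub_pos.mpr (errorFun_lt_one _), sub_lt_self _ hpos⟩
  · exact wrightW_neg_mem_Ioo_of_lt_half hν hν' hx

end ErrorFunction

section Space

variable {ν x t : ℝ}

lemma auxR_eventuallyEq_space (hν : 0 < ν) (hν' : ν ≤ 1 / 2) (μ : ℝ) (hx : 0 < x) (ht : 0 < t) :
    (fun x => auxR μ ν x t) =ᶠ[𝓝 x]
      fun x => t ^ (μ - 1) * wrightW (-x * t ^ (-ν)) (-ν) μ := by
  filter_upwards [Ioi_mem_nhds hx] with y hy
  exact auxR_eq_rpow_mul_wrightW hν hν' μ (le_of_lt hy) ht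

lemma hasDerivAt_auxR_space (hν : 0 < ν) (hν' : ν ≤ 1 / 2) (μ : ℝ) (hx : 0 < x) (ht : 0 < t) :
    HasDerivAt (fun x => auxR μ ν x t) (-auxR (μ - ν) ν x t) x := by
  have harg : HasDerivAt (fun x => -x * t ^ (-ν)) (-1 * t ^ (-ν)) x :=
    (hasDerivAt_neg x).mul_const _
  refine (((hasDerivAt_wrightW (by linarith) μ _).comp x harg).const_mul
    (t ^ (μ - 1))).congr_of_eventuallyEq (auxR_eventuallyEq_space hν hν' μ hx ht)
    |>.congr_deriv ?_
  rw [auxR_eq_rpow_mul_wrightW hν hν' _ hx.le ht, show μ - ν - 1 = (μ - 1) + -ν by ring,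
    Real.rpow_add ht]
  ring

lemma contDiffAt_auxR_space (hν : 0 < ν) (hν' : ν ≤ 1 / 2) (μ : ℝ) (hx : 0 < x) (ht : 0 < t)
    (n : WithTop ℕ∞) : ContDiffAt ℝ n (fun x => auxR μ ν x t) x := by
  have hW : ContDiff ℝ n fun z => wrightW z (-ν) μ := contDiff_iff_contDiffAt.mpr fun z =>
    (analyticOnNhd_wrightW (by linarith) μ z (mem_univ z)).contDiffAt
  exact (contDiff_const.mul (hW.comp (contDiff_neg.mul contDiff_const))).contDiffAt
    |>.congr_of_eventuallyEq (auxR_eventuallyEq_space hν hν' μ hx ht)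

lemma continuousOn_auxR_space (hν : 0 < ν) (hν' : ν ≤ 1 / 2) (μ : ℝ) (ht : 0 < t) :
    ContinuousOn (fun x => auxR μ ν x t) (Ici 0) :=
  (continuous_const.mul ((continuous_wrightW (by linarith) μ).comp
    (continuous_neg.mul continuous_const))).continuousOn.congr
      fun _ hx => auxR_eq_rpow_mul_wrightW hν hν' μ hx ht

lemma integrableOn_auxR_space (hν : 0 < ν) (hν' : ν ≤ 1 / 2) (μ : ℝ) (ht : 0 < t) :
    IntegrableOn (fun x => auxR μ ν x t) (Ioi 0) := by
  obtain ⟨C, c, hc, hC⟩ := exists_abs_auxR_le hν hν' μ one_pos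
  refine integrable_of_isBigO_exp_neg hc (continuousOn_auxR_space hν hν' μ ht)
    (Asymptotics.IsBigO.of_bound (C * Real.exp t) ?_)
  filter_upwards [eventually_ge_atTop 1] with x hx
  simpa [neg_mul] using hC x t hx

lemma integral_Ioi_auxR_space (hν : 0 < ν) (hν' : ν ≤ 1 / 2) (μ : ℝ) (ht : 0 < t) :
    ∫ x in Ioi 0, auxR μ ν x t = fracDelta (μ + ν) t := by
  have hderiv : ∀ x ∈ Ioi (0 : ℝ),
      HasDerivAt (fun x => -auxR (μ + ν) ν x t) (auxR μ ν x t) x := fun x hx => by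
    simpa using (hasDerivAt_auxR_space hν hν' (μ + ν) hx ht).fun_neg
  have hlim := (tendsto_auxR_atTop hν hν' (μ + ν) t).neg
  rw [integral_Ioi_of_hasDerivAt_of_tendsto
    ((continuousOn_auxR_space hν hν' _ ht).fun_neg 0 self_mem_Ici) hderiv
    (integrableOn_auxR_space hν hν' μ ht) hlim, auxR_zero_left]
  simp

end Space

section SimilaritySolution

variable {ν α x t : ℝ}

lemma similarityEta_pos (ν : ℝ) (hα : 0 < α) (ht : 0 < t) : 0 < similarityEta ν α t := by
  rw [similarityEta]
  positivity

lemma auxR_similarityEta (hν : 0 < ν) (hν' : ν ≤ 1 / 2) (μ : ℝ) (hα : 0 < α) (ht : 0 < t) :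
    auxR μ ν (similarityEta ν α t) t = t ^ (μ - 1) * wrightW (-2 * α) (-ν) μ := by
  rw [auxR_eq_rpow_mul_wrightW hν hν' μ (similarityEta_pos ν hα ht).le ht, similarityEta,
    ← neg_mul, mul_assoc, ← Real.rpow_add ht, add_neg_cancel, Real.rpow_zero, mul_one, neg_mul]

lemma wrightW_neg_two_mul_mem_Ioo (hν : 0 < ν) (hν' : ν ≤ 1 / 2) (hα : 0 < α) :
    wrightW (-2 * α) (-ν) 1 ∈ Ioo (0 : ℝ) 1 := by
  simpa only [neg_mul] using wrightW_neg_mem_Ioo hν hν' (mul_pos two_pos hα)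

lemma hasCaputoDeriv_similarityEta (hν : 0 < ν) (hν' : ν ≤ 1 / 2) (α : ℝ) (ht : 0 < t) :
    HasCaputoDeriv (2 * ν) (similarityEta ν α) t
      (2 * α * Real.Gamma (1 + ν) / Real.Gamma (1 - ν) * t ^ (-ν)) := by
  have hderiv : ∀ τ, 0 < τ → deriv (similarityEta ν α) τ = 2 * α * ν * τ ^ (ν - 1) :=
    fun τ hτ => by
      rw [mul_assoc]
      exact ((Real.hasDerivAt_rpow_const (Or.inl hτ.ne')).const_mul (2 * α)).deriv
  have hsmooth : ContDiffOn ℝ 1 (similarityEta ν α) (Ioi 0) := fun τ hτ =>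
    (contDiffAt_const.mul
      (Real.contDiffAt_rpow_const_of_ne (ne_of_gt hτ))).contDiffWithinAt
  rw [hasCaputoDeriv_two_mul_iff hν hν', add_comm 1 ν, Real.Gamma_add_one hν.ne']
  refine ⟨hsmooth, ?_⟩
  rcases hν'.eq_or_lt with rfl | hν'
  · refine ⟨Or.inl (by norm_num), ?_⟩
    rw [rlIntegral, if_pos (by norm_num), hderiv t ht, show (1 / 2 : ℝ) - 1 = -(1 / 2) by norm_num,
      show (1 : ℝ) - 1 / 2 = 1 / 2 by norm_num]
    have := (Real.Gamma_pos_of_pos hν).ne'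
    field_simp
  have hβ : 0 < 1 - 2 * ν := by linarith
  have hintegrand : EqOn
      (fun τ : ℝ => 2 * α * ν * ((t - τ) ^ (1 - 2 * ν - 1) * τ ^ (ν - 1)))
      (fun τ : ℝ => (t - τ) ^ (1 - 2 * ν - 1) * deriv (similarityEta ν α) τ) (uIoc 0 t) :=
    fun τ hτ => by
      rw [uIoc_of_le ht.le] at hτ
      simp only [hderiv τ hτ.1]
      ring
  refine ⟨Or.inr (((intervalIntegrable_sub_rpow_mul_rpow hβ hν ht).const_mul _).congr
    hintegrand), ?_⟩
  rw [rlIntegral, if_neg hβ.ne', ← intervalIntegral.integral_congr_ae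
    (Eventually.of_forall hintegrand), intervalIntegral.integral_const_mul,
    integral_sub_rpow_mul_rpow hβ hν ht, show 1 - 2 * ν + ν = 1 - ν by ring,
    show 1 - ν - 1 = -ν by ring]
  have := (Real.Gamma_pos_of_pos hβ).ne'
  field_simp

lemma hasDerivAt_similarityU (hν : 0 < ν) (hν' : ν ≤ 1 / 2) (α : ℝ) (hx : 0 < x) (ht : 0 < t) :
    HasDerivAt (fun ξ => similarityU ν α ξ t)
      (-auxR (1 - ν) ν x t / (1 - wrightW (-2 * α) (-ν) 1)) x :=
  ((hasDerivAt_auxR_space hν hν' 1 hx ht).sub_const _).div_const _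

lemma iteratedDeriv_two_similarityU (hν : 0 < ν) (hν' : ν ≤ 1 / 2) (α : ℝ) (hx : 0 < x)
    (ht : 0 < t) : iteratedDeriv 2 (fun ξ => similarityU ν α ξ t) x =
      auxR (1 - 2 * ν) ν x t / (1 - wrightW (-2 * α) (-ν) 1) := by
  have hfirst : deriv (fun ξ => similarityU ν α ξ t) =ᶠ[𝓝 x]
      fun ξ => -auxR (1 - ν) ν ξ t / (1 - wrightW (-2 * α) (-ν) 1) := by
    filter_upwards [Ioi_mem_nhds hx] with ξ hξ
    exact (hasDerivAt_similarityU hν hν' α hξ ht).deriv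
  have hsecond := (hasDerivAt_auxR_space hν hν' (1 - ν) hx ht).fun_neg.div_const
    (1 - wrightW (-2 * α) (-ν) 1)
  rw [iteratedDeriv_succ, iteratedDeriv_one, hfirst.deriv_eq, hsecond.deriv, neg_neg, sub_sub,
    two_mul]

lemma hasCaputoDeriv_similarityU (hν : 0 < ν) (hν' : ν ≤ 1 / 2) (α : ℝ) (hx : 0 < x)
    (ht : 0 < t) : HasCaputoDeriv (2 * ν) (fun τ => similarityU ν α x τ) t
      (auxR (1 - 2 * ν) ν x t / (1 - wrightW (-2 * α) (-ν) 1)) := by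
  have hβ : 0 ≤ 1 - 2 * ν := by linarith
  have hderiv : deriv (fun τ => similarityU ν α x τ) =
      fun τ => (1 - wrightW (-2 * α) (-ν) 1)⁻¹ * auxR 0 ν x τ := by
    ext τ
    refine (((hasDerivAt_auxR_time hν hν' 1 hx τ).sub_const _).div_const _).deriv.trans ?_
    rw [sub_self, div_eq_inv_mul]
  rw [hasCaputoDeriv_two_mul_iff hν hν', hderiv]
  refine ⟨(((contDiff_one_auxR_time hν hν' 1 hx).sub contDiff_const).div_const _).contDiffOn,
    rlIntegrable_const_mul_auxR hν hν' 0 hx hβ t _, ?_⟩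
  rw [rlIntegral_const_mul_auxR hν hν' 0 hx hβ ht.le, zero_add, div_eq_inv_mul]

lemma tendsto_similarityU_time_zero (hν : 0 < ν) (hν' : ν ≤ 1 / 2) (α : ℝ) (hx : 0 < x) :
    Tendsto (fun t => similarityU ν α x t) (𝓝[>] 0)
      (𝓝 (-wrightW (-2 * α) (-ν) 1 / (1 - wrightW (-2 * α) (-ν) 1))) := by
  rw [← zero_sub]
  exact ((tendsto_auxR_time_zero hν hν' 1 hx).sub_const _).div_const _

lemma transcendentalEq_iff (hν : 0 < ν) (hν' : ν ≤ 1 / 2) {r : ℝ} (hr : 0 < r) (hα : 0 < α)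
    (ht : 0 < t) :
    TranscendentalEq ν r α ↔ 2 * α * Real.Gamma (1 + ν) / Real.Gamma (1 - ν) * t ^ (-ν) =
      -(1 / r) * (-auxR (1 - ν) ν (similarityEta ν α t) t /
        (1 - wrightW (-2 * α) (-ν) 1)) := by
  have hW : 0 < 1 - wrightW (-2 * α) (-ν) 1 :=
    sub_pos.mpr (wrightW_neg_two_mul_mem_Ioo hν hν' hα).2
  have : 0 < t ^ (-ν) := by positivity
  have hΓ := Real.Gamma_pos_of_pos (by linarith : 0 < 1 - ν)
  rw [TranscendentalEq, auxR_similarityEta hν hν' _ hα ht, show 1 - ν - 1 = -ν by ring]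
  generalize wrightW (-2 * α) (-ν) 1 = w at hW ⊢
  field_simp

lemma isCaputoStefanSolution_similarity (hν : 0 < ν) (hν' : ν ≤ 1 / 2) {r : ℝ} (hr : 0 < r)
    (hα : 0 < α) (heq : TranscendentalEq ν r α) :
    IsCaputoStefanSolution ν r (-wrightW (-2 * α) (-ν) 1 / (1 - wrightW (-2 * α) (-ν) 1))
      (similarityU ν α) (similarityEta ν α) where
  boundary_pos t ht := similarityEta_pos ν hα ht
  pde t ht x hx _ := by
    refine ⟨((contDiffAt_auxR_space hν hν' 1 hx ht 2).sub contDiffAt_const).div_const _, ?_⟩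
    rw [iteratedDeriv_two_similarityU hν hν' α hx ht]
    exact hasCaputoDeriv_similarityU hν hν' α hx ht
  initial x hx := tendsto_similarityU_time_zero hν hν' α hx
  left_value t _ := by
    have hW := sub_pos.mpr (wrightW_neg_two_mul_mem_Ioo hν hν' hα).2
    rw [similarityU, auxR_zero_left, fracDelta, sub_self, Real.rpow_zero, Real.Gamma_one,
      div_one, div_self hW.ne']
  left_continuous t ht := ((continuousOn_auxR_space hν hν' 1 ht 0 self_mem_Ici).sub
    continuousWithinAt_const).div_const _
  right_value t ht := by
    rw [similarityU, auxR_similarityEta hν hν' 1 hα ht, sub_self 1, Real.rpow_zero, one_mul,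
      sub_self, zero_div]
  stefan t ht := by
    refine ⟨_, (hasDerivAt_similarityU hν hν' α
      (similarityEta_pos ν hα ht) ht).hasDerivWithinAt, ?_⟩
    rw [← (transcendentalEq_iff hν hν' hr hα ht).mp heq]
    exact hasCaputoDeriv_similarityEta hν hν' α ht

lemma isCaputoStefanSolution_similarity_iff (hν : 0 < ν) (hν' : ν ≤ 1 / 2) {r : ℝ} (u₀ : ℝ)
    (hr : 0 < r) (hα : 0 < α) :
    IsCaputoStefanSolution ν r u₀ (similarityU ν α) (similarityEta ν α) ↔
      u₀ = -wrightW (-2 * α) (-ν) 1 / (1 - wrightW (-2 * α) (-ν) 1) ∧ TranscendentalEq ν r α := by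
  refine ⟨fun hsol => ⟨tendsto_nhds_unique (hsol.initial 1 one_pos)
    (tendsto_similarityU_time_zero hν hν' α one_pos), ?_⟩, fun ⟨hu₀, heq⟩ =>
    hu₀ ▸ isCaputoStefanSolution_similarity hν hν' hr hα heq⟩
  obtain ⟨q, hq, hstefan⟩ := hsol.stefan 1 one_pos
  have hslope := (uniqueDiffWithinAt_Iic _).eq_deriv _ hq (hasDerivAt_similarityU hν hν' α
    (similarityEta_pos ν hα one_pos) one_pos).hasDerivWithinAt
  rw [hasCaputoDeriv_two_mul_iff hν hν'] at hstefan
  have heta := (hasCaputoDeriv_two_mul_iff hν hν' _ _ _).mp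
    (hasCaputoDeriv_similarityEta hν hν' α one_pos)
  rw [transcendentalEq_iff hν hν' hr hα one_pos, ← hslope, ← hstefan.2.2, ← heta.2.2]

lemma exists_pos_mul_one_sub_eq {v w : ℝ → ℝ} {c : ℝ} (hv : Continuous v) (hw : Continuous w)
    (hvlim : Tendsto v atTop (𝓝 0)) (hwlim : Tendsto w atTop (𝓝 0)) (hc : 0 < c)
    (hw₀ : 0 < w 0) : ∃ α, 0 < α ∧ c * α * (1 - v α) = w α := by
  have hdiff : Tendsto (fun α => c * α * (1 - v α) - w α) atTop atTop := by
    have hfactor : Tendsto (fun α => 1 - v α) atTop (𝓝 1) := by simpa using hvlim.const_sub 1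
    simpa [sub_eq_add_neg] using
      ((tendsto_id.const_mul_atTop hc).atTop_mul_pos one_pos hfactor).atTop_add hwlim.neg
  obtain ⟨A, hA, hA₀⟩ := ((hdiff.eventually_ge_atTop 0).and (eventually_ge_atTop 0)).exists
  have hcont : ContinuousOn (fun α => c * α * (1 - v α) - w α) (Icc 0 A) := by fun_prop
  obtain ⟨α, hα, hroot⟩ := intermediate_value_Icc hA₀ hcont ⟨by simpa using hw₀.le, hA⟩
  refine ⟨α, lt_of_le_of_ne hα.1 ?_, sub_eq_zero.mp hroot⟩
  rintro rfl
  simp only [mul_zero, zero_mul, zero_sub, neg_eq_zero] at hroot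
  exact hw₀.ne' hroot

lemma exists_transcendentalEq (hν : 0 < ν) (hν' : ν ≤ 1 / 2) {r : ℝ} (hr : 0 < r) :
    ∃ α, 0 < α ∧ TranscendentalEq ν r α := by
  have hcont : ∀ μ, Continuous fun α => wrightW (-2 * α) (-ν) μ := fun μ =>
    (continuous_wrightW (by linarith) μ).comp (continuous_const.mul continuous_id)
  have hΓ := Real.Gamma_pos_of_pos (by linarith : 0 < 1 - ν)
  have := Real.Gamma_pos_of_pos (by linarith : 0 < 1 + ν)
  obtain ⟨α, hα, heq⟩ := exists_pos_mul_one_sub_eq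
    (c := 2 * r * Real.Gamma (1 + ν) / Real.Gamma (1 - ν)) (hcont 1) (hcont (1 - ν))
    (tendsto_wrightW_neg_two_mul_atTop hν hν' 1) (tendsto_wrightW_neg_two_mul_atTop hν hν' (1 - ν))
    (by positivity) (by simpa [wrightW_zero] using hΓ)
  refine ⟨α, hα, ?_⟩
  rw [TranscendentalEq, ← heq]
  ring

lemma similarityU_half (hα : 0 < α) (hx : 0 ≤ x) (ht : 0 < t) :
    similarityU (1 / 2) α x t = 1 - errorFun (x / (2 * √t)) / errorFun α := by
  have herf : errorFun α ≠ 0 := (errorFun_zero ▸ strictMono_errorFun hα).ne'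
  have hsqrt : √t ≠ 0 := (Real.sqrt_pos.mpr ht).ne'
  have harg : -x * t ^ (-(1 / 2) : ℝ) = -2 * (x / (2 * √t)) := by
    rw [Real.rpow_neg ht.le, ← Real.sqrt_eq_rpow]
    field_simp
  rw [similarityU, auxR_eq_rpow_mul_wrightW one_half_pos le_rfl 1 hx ht, harg,
    wrightW_neg_half_one, wrightW_neg_half_one, sub_self 1, Real.rpow_zero, one_mul,
    sub_sub_sub_cancel_left, sub_sub_cancel, sub_div, div_self herf]

lemma transcendentalEq_half_iff {r : ℝ} :
    TranscendentalEq (1 / 2) r α ↔ r * √π * α * errorFun α * Real.exp (α ^ 2) = 1 := by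
  have hΓ : Real.Gamma (1 + 1 / 2) = 1 / 2 * √π := by
    rw [add_comm, Real.Gamma_add_one (by norm_num), Real.Gamma_one_half_eq]
  rw [TranscendentalEq, hΓ, show (1 : ℝ) - 1 / 2 = 1 / 2 by norm_num, Real.Gamma_one_half_eq,
    wrightW_neg_half_one, wrightW_neg_half_half, show (-2 * α) ^ 2 / 4 = α ^ 2 by ring,
    Real.exp_neg, sub_sub_cancel]
  have := Real.exp_ne_zero (α ^ 2)
  have := (Real.sqrt_pos.mpr Real.pi_pos).ne'
  field_simp

end SimilaritySolution

section HalfLineConvolution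

open scoped Convolution

variable {f g k : ℝ → ℝ} {t : ℝ}

lemma integral_indicator_Ioo_eq (f : ℝ → ℝ) (ht : 0 ≤ t) :
    ∫ τ, (Ioo 0 t).indicator f τ = ∫ τ in 0..t, f τ := by
  rw [integral_indicator measurableSet_Ioo, intervalIntegral.integral_of_le ht,
    integral_Ioc_eq_integral_Ioo]

lemma integral_indicator_Ioo_mul_indicator_Ioo {s : ℝ} (f g : ℝ → ℝ) (hs : 0 ≤ s)
    (hst : s ≤ t) :
    ∫ τ, (Ioo 0 t).indicator f τ * (Ioo 0 t).indicator g (s - τ) =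
      ∫ τ in 0..s, f τ * g (s - τ) := by
  rw [← integral_indicator_Ioo_eq _ hs]
  congr with τ
  simp only [indicator_apply, mem_Ioo]
  grind

lemma exists_abs_indicator_Ioo_le (hk : ContinuousOn k (Icc 0 t)) :
    ∃ C, ∀ x, |(Ioo 0 t).indicator k x| ≤ C := by
  obtain ⟨C, hC⟩ := isCompact_Icc.exists_bound_of_continuousOn hk
  refine ⟨max C 0, fun x => ?_⟩
  by_cases hx : x ∈ Ioo 0 t
  · rw [indicator_of_mem hx]
    exact (hC x (Ioo_subset_Icc_self hx)).trans (le_max_left C 0)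
  · rw [indicator_of_notMem hx, abs_zero]
    exact le_max_right C 0

lemma norm_convolution_norm_le (hg : Integrable g) {C : ℝ} (hk : ∀ x, |k x| ≤ C) (x : ℝ) :
    ‖((fun y => ‖g y‖) ⋆[ContinuousLinearMap.mul ℝ ℝ] fun y => ‖k y‖) x‖ ≤ (∫ y, ‖g y‖) * C := by
  rw [← integral_mul_const]
  refine norm_integral_le_of_norm_le (hg.norm.mul_const C) (Eventually.of_forall fun y => ?_)
  rw [ContinuousLinearMap.mul_apply', norm_mul, norm_norm, norm_norm]
  exact mul_le_mul_of_nonneg_left (hk _) (norm_nonneg _)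

/-- The boundedness of `k` makes the iterated convolution converge absolutely at every point. -/
lemma convolution_assoc_of_bounded (hf : Integrable f) (hg : Integrable g) (hk : Integrable k)
    {C : ℝ} (hkC : ∀ x, |k x| ≤ C) (x : ℝ) :
    ((f ⋆[ContinuousLinearMap.mul ℝ ℝ] g) ⋆[ContinuousLinearMap.mul ℝ ℝ] k) x =
      (f ⋆[ContinuousLinearMap.mul ℝ ℝ] g ⋆[ContinuousLinearMap.mul ℝ ℝ] k) x := by
  refine convolution_assoc _ _ _ _ (fun a b c => mul_assoc a b c) hf.aestronglyMeasurable
    hg.aestronglyMeasurable hk.aestronglyMeasurable (hf.ae_convolution_exists _ hg)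
    (hg.norm.ae_convolution_exists _ hk.norm) ?_
  have hgk := hg.norm.integrable_convolution (ContinuousLinearMap.mul ℝ ℝ) hk.norm
  exact hf.norm.mul_bdd ((hgk.comp_sub_left x).aestronglyMeasurable)
    (Eventually.of_forall fun y => norm_convolution_norm_le hg hkC (x - y))

lemma integral_mul_integral_sub_eq (ht : 0 ≤ t) (hf : IntervalIntegrable f volume 0 t)
    (hg : IntervalIntegrable g volume 0 t) (hk : ContinuousOn k (Icc 0 t)) :
    ∫ τ in 0..t, f τ * ∫ σ in 0..t - τ, g σ * k (t - τ - σ) =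
      ∫ σ in 0..t, (∫ τ in 0..σ, f τ * g (σ - τ)) * k (t - σ) := by
  have htrunc : ∀ {h : ℝ → ℝ}, IntervalIntegrable h volume 0 t →
      Integrable ((Ioo 0 t).indicator h) := fun hh =>
    ((intervalIntegrable_iff_integrableOn_Ioo_of_le ht).mp hh).integrable_indicator
      measurableSet_Ioo
  obtain ⟨C, hC⟩ := exists_abs_indicator_Ioo_le hk
  have hassoc := convolution_assoc_of_bounded (htrunc hf) (htrunc hg)
    (htrunc (hk.intervalIntegrable_of_Icc ht)) hC t
  simp only [convolution_def, ContinuousLinearMap.mul_apply'] at hassoc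
  have hsub : ∀ {τ : ℝ}, τ ∈ Ioo 0 t → t - τ ∈ Ioo 0 t := fun hτ => by
    constructor <;> linarith [hτ.1, hτ.2]
  calc ∫ τ in 0..t, f τ * ∫ σ in 0..t - τ, g σ * k (t - τ - σ)
    _ = ∫ τ, (Ioo 0 t).indicator f τ *
          ∫ σ, (Ioo 0 t).indicator g σ * (Ioo 0 t).indicator k (t - τ - σ) := by
      rw [← integral_indicator_Ioo_eq _ ht]
      congr with τ
      by_cases hτ : τ ∈ Ioo 0 t
      · rw [indicator_of_mem hτ, indicator_of_mem hτ, integral_indicator_Ioo_mul_indicator_Ioo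
          _ _ (hsub hτ).1.le (hsub hτ).2.le]
      · rw [indicator_of_notMem hτ, indicator_of_notMem hτ, zero_mul]
    _ = ∫ σ, (∫ τ, (Ioo 0 t).indicator f τ * (Ioo 0 t).indicator g (σ - τ)) *
          (Ioo 0 t).indicator k (t - σ) := hassoc.symm
    _ = ∫ σ in 0..t, (∫ τ in 0..σ, f τ * g (σ - τ)) * k (t - σ) := by
      rw [← integral_indicator_Ioo_eq _ ht]
      congr with σ
      by_cases hσ : σ ∈ Ioo 0 t
      · rw [indicator_of_mem hσ, indicator_of_mem (hsub hσ),
          integral_indicator_Ioo_mul_indicator_Ioo _ _ hσ.1.le hσ.2.le]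
      · rw [indicator_of_notMem hσ, indicator_of_notMem fun h =>
          hσ (by simpa only [sub_sub_cancel] using hsub h), mul_zero]

end HalfLineConvolution

section Embedding

variable {ν u₀ c x t : ℝ} {φ : ℝ → ℝ}

lemma intervalIntegrable_fracDelta {μ : ℝ} (hμ : 0 < μ) (t : ℝ) :
    IntervalIntegrable (fracDelta μ) volume 0 t :=
  (intervalIntegral.intervalIntegrable_rpow' (by linarith)).div_const _

lemma fracDelta_one (t : ℝ) : fracDelta 1 t = 1 := by
  simp [fracDelta]

lemma integral_fracDelta_mul_auxR (hν : 0 < ν) (hν' : ν ≤ 1 / 2) (μ : ℝ) {β : ℝ} (hβ : 0 < β)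
    (hx : 0 < x) (ht : 0 ≤ t) :
    ∫ σ in 0..t, fracDelta β σ * auxR μ ν x (t - σ) = auxR (μ + β) ν x t := by
  have hΓ := (Real.Gamma_pos_of_pos hβ).ne'
  have hflip := intervalIntegral.integral_comp_sub_left (a := 0) (b := t)
    (fun σ => fracDelta β σ * auxR μ ν x (t - σ)) t
  simp only [sub_self, sub_zero] at hflip
  rw [← hflip]
  simp only [sub_sub_cancel, fracDelta, div_mul_eq_mul_div]
  rw [intervalIntegral.integral_div, integral_sub_rpow_mul_auxR hν hν' μ hx hβ ht,
    mul_div_cancel_left₀ _ hΓ]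

lemma integral_fracDelta_mul_fracDelta {a b : ℝ} (ha : 0 < a) (hb : 0 < b) (ht : 0 < t) :
    ∫ τ in 0..t, fracDelta a (t - τ) * fracDelta b τ = fracDelta (a + b) t := by
  have hΓa := (Real.Gamma_pos_of_pos ha).ne'
  have hΓb := (Real.Gamma_pos_of_pos hb).ne'
  simp only [fracDelta, div_mul_div_comm]
  rw [intervalIntegral.integral_div, integral_sub_rpow_mul_rpow ha hb ht]
  field_simp

lemma integral_half_mul_auxR_abs_sub (hν : 0 < ν) (hν' : ν ≤ 1 / 2) (u₀ x : ℝ) (ht : 0 < t) :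
    ∫ ξ, 1 / 2 * auxR ν ν |x - ξ| t * (if ξ = 0 then 0 else u₀) = u₀ * fracDelta (2 * ν) t := by
  calc ∫ ξ, 1 / 2 * auxR ν ν |x - ξ| t * (if ξ = 0 then 0 else u₀)
    _ = ∫ ξ, u₀ / 2 * auxR ν ν |x - ξ| t := by
      refine integral_congr_ae ?_
      filter_upwards [compl_mem_ae_iff.mpr (measure_singleton (0 : ℝ))] with ξ hξ
      rw [if_neg (by simpa only [mem_compl_iff, mem_singleton_iff] using hξ)]
      ring
    _ = u₀ * ∫ ξ in Ioi 0, auxR ν ν ξ t := by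
      rw [integral_const_mul, integral_sub_left_eq_self (fun ξ => auxR ν ν |ξ| t) volume x,
        integral_comp_abs (f := fun ξ => auxR ν ν ξ t)]
      ring
    _ = u₀ * fracDelta (2 * ν) t := by
      rw [integral_Ioi_auxR_space hν hν' ν ht, ← two_mul]

lemma rlEmbedding_eq (hν : 0 < ν) (hν' : ν ≤ 1 / 2) (u₀ : ℝ) (φ : ℝ → ℝ) (c x : ℝ)
    (ht : 0 < t) : rlEmbedding ν u₀ φ c x t = u₀ * fracDelta (2 * ν) t +
      1 / 2 * ((∫ τ in 0..t, φ τ * auxR (2 * ν) ν x (t - τ)) + c * auxR (2 * ν) ν x t) := by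
  have hcomm : ∀ τ, 1 / 2 * auxR (2 * ν) ν x (t - τ) * φ τ =
      1 / 2 * (φ τ * auxR (2 * ν) ν x (t - τ)) := fun τ => by ring
  simp only [rlEmbedding, integral_half_mul_auxR_abs_sub hν hν' u₀ x ht, hcomm,
    intervalIntegral.integral_const_mul]
  ring

/-- Since `R_{2ν,ν}(x,·) = δ_{2ν} * R_{0,ν}(x,·)`, the associativity of the convolution recovers
the source term from its value `φ * δ_{2ν}` at `x = 0`. -/
lemma integral_mul_auxR_eq_of_integral_mul_fracDelta (hν : 0 < ν) (hν' : ν ≤ 1 / 2) {κ : ℝ}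
    (hx : 0 < x) (ht : 0 < t) (hφ : IntervalIntegrable φ volume 0 t)
    (hsource : ∀ s, 0 < s →
      ∫ τ in 0..s, φ τ * fracDelta (2 * ν) (s - τ) = 2 - κ * fracDelta (2 * ν) s) :
    ∫ τ in 0..t, φ τ * auxR (2 * ν) ν x (t - τ) =
      2 * auxR 1 ν x t - κ * auxR (2 * ν) ν x t := by
  have h2ν : 0 < 2 * ν := by linarith
  have hR : Continuous (auxR 0 ν x) := continuous_auxR_time hν hν' 0 hx
  have hδ := fun {s : ℝ} => integral_fracDelta_mul_auxR (t := s) hν hν' 0 h2ν hx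
  have hone := integral_fracDelta_mul_auxR hν hν' 0 one_pos hx ht.le
  simp only [zero_add, fracDelta_one, one_mul] at hδ hone
  calc ∫ τ in 0..t, φ τ * auxR (2 * ν) ν x (t - τ)
    _ = ∫ τ in 0..t, φ τ * ∫ σ in 0..t - τ, fracDelta (2 * ν) σ * auxR 0 ν x (t - τ - σ) := by
      refine intervalIntegral.integral_congr fun τ hτ => ?_
      rw [uIcc_of_le ht.le] at hτ
      simp only [hδ (sub_nonneg.mpr hτ.2)]
    _ = ∫ σ in 0..t, (∫ τ in 0..σ, φ τ * fracDelta (2 * ν) (σ - τ)) * auxR 0 ν x (t - σ) :=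
      integral_mul_integral_sub_eq ht.le hφ (intervalIntegrable_fracDelta h2ν t) hR.continuousOn
    _ = ∫ σ in 0..t, (2 * auxR 0 ν x (t - σ) -
          κ * (fracDelta (2 * ν) σ * auxR 0 ν x (t - σ))) := by
      refine intervalIntegral.integral_congr_ae (Eventually.of_forall fun σ hσ => ?_)
      rw [uIoc_of_le ht.le] at hσ
      rw [hsource σ hσ.1]
      ring
    _ = 2 * auxR 1 ν x t - κ * auxR (2 * ν) ν x t := by
      have hshift : ContinuousOn (fun σ => auxR 0 ν x (t - σ)) (uIcc 0 t) := by fun_prop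
      rw [intervalIntegral.integral_sub (hshift.intervalIntegrable.const_mul 2)
        (((intervalIntegrable_fracDelta h2ν t).mul_continuousOn hshift).const_mul κ),
        intervalIntegral.integral_const_mul, intervalIntegral.integral_const_mul, hδ ht.le, hone]

lemma rlEmbedding_eq_of_left_value (hν : 0 < ν) (hν' : ν ≤ 1 / 2)
    (hφ : ∀ t > 0, IntervalIntegrable φ volume 0 t)
    (hleft : ∀ t > 0, rlEmbedding ν u₀ φ c 0 t = 1) (hx : 0 ≤ x) (ht : 0 < t) :
    rlEmbedding ν u₀ φ c x t =
      u₀ * fracDelta (2 * ν) t + auxR 1 ν x t - u₀ * auxR (2 * ν) ν x t := by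
  rcases hx.eq_or_lt with rfl | hx
  · rw [hleft t ht, auxR_zero_left, auxR_zero_left, fracDelta_one]
    ring
  have hsource : ∀ s, 0 < s →
      ∫ τ in 0..s, φ τ * fracDelta (2 * ν) (s - τ) =
        2 - (2 * u₀ + c) * fracDelta (2 * ν) s := fun s hs => by
    have hs₁ := hleft s hs
    rw [rlEmbedding_eq hν hν' u₀ φ c 0 hs] at hs₁
    simp only [auxR_zero_left] at hs₁
    linear_combination 2 * hs₁
  rw [rlEmbedding_eq hν hν' u₀ φ c x ht,
    integral_mul_auxR_eq_of_integral_mul_fracDelta hν hν' hx ht (hφ t ht) hsource]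
  ring

lemma intervalIntegrable_two_mul_fracDelta (hν' : ν < 1 / 2) (t : ℝ) :
    IntervalIntegrable (fun τ => 2 * fracDelta (1 - 2 * ν) τ) volume 0 t :=
  (intervalIntegrable_fracDelta (by linarith) t).const_mul 2

lemma rlEmbedding_two_mul_fracDelta_left_value (hν : 0 < ν) (hν' : ν < 1 / 2) (u₀ : ℝ)
    (ht : 0 < t) :
    rlEmbedding ν u₀ (fun τ => 2 * fracDelta (1 - 2 * ν) τ) (-2 * u₀) 0 t = 1 := by
  have hδ := integral_fracDelta_mul_fracDelta (a := 2 * ν) (b := 1 - 2 * ν) (by linarith)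
    (by linarith) ht
  have hcomm : ∀ τ, 2 * fracDelta (1 - 2 * ν) τ * fracDelta (2 * ν) (t - τ) =
      2 * (fracDelta (2 * ν) (t - τ) * fracDelta (1 - 2 * ν) τ) := fun τ => by ring
  rw [add_sub_cancel, fracDelta_one] at hδ
  simp only [rlEmbedding_eq hν hν'.le u₀ _ _ 0 ht, auxR_zero_left, hcomm,
    intervalIntegral.integral_const_mul, hδ]
  ring

lemma rlEmbedding_not_boundary_values (hν : 0 < ν) (hν' : ν < 1 / 2) {α : ℝ} (hα : 0 < α)
    (hφ : ∀ t > 0, IntervalIntegrable φ volume 0 t) :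
    ¬ ((∀ t > 0, rlEmbedding ν u₀ φ c 0 t = 1) ∧
      (∀ t > 0, rlEmbedding ν u₀ φ c (similarityEta ν α t) t = 0)) := by
  rintro ⟨hleft, hright⟩
  have hdecay : Tendsto (fun t : ℝ => t ^ (2 * ν - 1)) atTop (𝓝 0) := by
    simpa only [neg_sub] using tendsto_rpow_neg_atTop (by linarith : 0 < 1 - 2 * ν)
  have hlim := (hdecay.const_mul (u₀ / Real.Gamma (2 * ν) -
    u₀ * wrightW (-2 * α) (-ν) (2 * ν))).const_add (wrightW (-2 * α) (-ν) 1)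
  have hzero : (fun t : ℝ => wrightW (-2 * α) (-ν) 1 + (u₀ / Real.Gamma (2 * ν) -
      u₀ * wrightW (-2 * α) (-ν) (2 * ν)) * t ^ (2 * ν - 1)) =ᶠ[atTop] fun _ => 0 := by
    filter_upwards [eventually_gt_atTop 0] with t ht
    have hη := hright t ht
    rw [rlEmbedding_eq_of_left_value hν hν'.le hφ hleft (similarityEta_pos ν hα ht).le ht,
      auxR_similarityEta hν hν'.le _ hα ht, auxR_similarityEta hν hν'.le _ hα ht, sub_self,
      Real.rpow_zero, fracDelta] at hη
    linear_combination hη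
  have hW : wrightW (-2 * α) (-ν) 1 = 0 := by
    simpa only [mul_zero, add_zero] using tendsto_nhds_unique hlim
      (tendsto_const_nhds.congr' hzero.symm)
  exact (wrightW_neg_two_mul_mem_Ioo hν hν'.le hα).1.ne' hW

end Embedding

theorem mainTheorem1 :
    (∀ ν r : ℝ, 0 < ν → ν ≤ 1 / 2 → 0 < r →
      (∃ α : ℝ, 0 < α ∧ TranscendentalEq ν r α) ∧
      (∀ α u₀ : ℝ, 0 < α →
        wrightW (-2 * α) (-ν) 1 ≠ 1 ∧
        (IsCaputoStefanSolution ν r u₀ (similarityU ν α) (similarityEta ν α) ↔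
          (u₀ = -wrightW (-2 * α) (-ν) 1 / (1 - wrightW (-2 * α) (-ν) 1) ∧
            TranscendentalEq ν r α)))) ∧
    (∀ ν u₀ : ℝ, 0 < ν → ν < 1 / 2 →
      ((∀ t > 0, IntervalIntegrable (fun τ => 2 * fracDelta (1 - 2 * ν) τ)
          MeasureTheory.volume 0 t) ∧
        (∀ t > 0, rlEmbedding ν u₀ (fun τ => 2 * fracDelta (1 - 2 * ν) τ) (-2 * u₀) 0 t = 1) ∧
        (∀ x t : ℝ, 0 ≤ x → 0 < t →
          rlEmbedding ν u₀ (fun τ => 2 * fracDelta (1 - 2 * ν) τ) (-2 * u₀) x t =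
            u₀ * fracDelta (2 * ν) t + auxR 1 ν x t - u₀ * auxR (2 * ν) ν x t)) ∧
      (∀ (φ : ℝ → ℝ) (c : ℝ),
        (∀ t > 0, IntervalIntegrable φ MeasureTheory.volume 0 t) →
        ∀ α : ℝ, 0 < α →
          ¬ ((∀ t > 0, rlEmbedding ν u₀ φ c 0 t = 1) ∧
              (∀ t > 0, rlEmbedding ν u₀ φ c (similarityEta ν α t) t = 0)) ∧
          ∀ r : ℝ, 0 < r →
            ¬ IsRLStefanSolution ν r u₀ (rlEmbedding ν u₀ φ c) (similarityEta ν α))) ∧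
    (∀ α : ℝ, 0 < α →
      (∀ x t : ℝ, 0 ≤ x → 0 < t →
        similarityU (1 / 2) α x t = 1 - errorFun (x / (2 * Real.sqrt t)) / errorFun α) ∧
      (∀ t : ℝ, 0 ≤ t → similarityEta (1 / 2) α t = 2 * α * Real.sqrt t) ∧
      (∀ r : ℝ, 0 < r →
        (TranscendentalEq (1 / 2) r α ↔
          r * Real.sqrt Real.pi * α * errorFun α * Real.exp (α ^ 2) = 1))) := by
  refine ⟨fun ν r hν hν' hr => ⟨exists_transcendentalEq hν hν' hr, fun α u₀ hα =>
      ⟨(wrightW_neg_two_mul_mem_Ioo hν hν' hα).2.ne,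
        isCaputoStefanSolution_similarity_iff hν hν' u₀ hr hα⟩⟩,
    fun ν u₀ hν hν' => ?_,
    fun α hα => ⟨fun x t hx ht => similarityU_half hα hx ht,
      fun t _ => by rw [similarityEta, Real.sqrt_eq_rpow],
      fun r _ => transcendentalEq_half_iff⟩⟩
  have hφ := fun t (_ : t > 0) => intervalIntegrable_two_mul_fracDelta hν' t
  have hleft := fun t (ht : t > 0) => rlEmbedding_two_mul_fracDelta_left_value hν hν' u₀ ht
  refine ⟨⟨hφ, hleft, fun x t hx ht => rlEmbedding_eq_of_left_value hν hν'.le hφ hleft hx ht⟩,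
    fun φ c hφ α hα => ?_⟩
  have hnot := rlEmbedding_not_boundary_values (u₀ := u₀) (c := c) hν hν' hα hφ
  exact ⟨hnot, fun r _ hsol => hnot ⟨hsol.left_value, hsol.right_value⟩⟩
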